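/- **Setting.** Let $m,B\ge 1$ and $d\ge 0$ be integers, and let $\mathcal G(0),\mathcal G(1),\dots$ be directed graphs on $\{1,\dots,m\}$ with edge sets $\mathcal E(t)$ that are $B$-strongly connected: for every $k\ge 0$ the graph with edge set $\bigcup_{t=kB}^{(k+1)B-1}\mathcal E(t)$ is strongly connected. Put $\mathcal N_i^{in}(t)=\{j:(j,i)\in\mathcal E(t)\}\cup\{i\}$, $d_j(t)=|\{i:(j,i)\in\mathcal E(t)\}\cup\{j\}|$, and let $A(t)$ be the column-stochastic matrix with $A_{ij}(t)=1/d_j(t)$ if $j\in\mathcal N_i^{in}(t)$ and $A_{ij}(t)=0$ otherwise. Call $\delta,\lambda$ *mixing constants* of the graph sequence if $\delta>0$ and $[A(t)\cdots A(0)\mathbf 1]_i\ge\delta$ for all $t,i$, and if $0\le\lambda<1$ and there are stochastic vectors $\phi(t)$ with $\bigl|[A(t)\cdots A(s)]_{ij}-\phi_i(t)\bigr|\le 4\lambda^{t-s}$ for all $t\ge s\ge 0$ and all $i,j$. Let $U_1,\dots,U_m:\mathbb R^d\to\mathbb R$ be differentiable and $\mu$-strongly convex ($\mu>0$), with $L$-Lipschitz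 gradients, and let $\alpha(t)=\alpha(0)/(1+t)$ with $\alpha(0)>0$. From deterministic $X_{(i)}(0)\in\mathbb R^d$ and $Y_{(i)}(0)=1$ let $$Y(t+1)=A(t)Y(t),\qquad Z_{(i)}(t+1)=\frac{\sum_j A_{ij}(t)X_{(j)}(t)}{Y_{(i)}(t+1)},\qquad X_{(i)}(t+1)=\sum_j A_{ij}(t)X_{(j)}(t)+e_i(t+1),$$ $$e_i(t)=-\alpha(t)\nabla U_i(Z_{(i)}(t))+\sqrt{2\alpha(t)}\,B_{(i)}(t),\qquad B_{(i)}(t)=\sqrt{\alpha(t)}\,\xi_{(i)}(t)+R_{(i)}(t)\qquad(t\ge1).$$ Here, for a filtration $(\mathcal F_t)$, the variables $\xi_{(i)}(t+1)$ and $R_{(i)}(t+1)$ are $\mathcal F_{t+1}$-measurable, $\mathbb E[\xi_{(i)}(t+1)\mid\mathcal F_t]=0$, $\mathbb E\|\xi_{(i)}(t+1)\|^2\le\sigma^2$, and $R_{(i)}(t+1)$ is independent of $\mathcal F_t$ with law $N(0,\rho^2 I_d)$. Let $\bar X(t)=\frac1m\sum_{i=1}^m X_{(i)}(t)$; $\|\cdot\|$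 is the Euclidean norm. **Lemma.** 1. Every $B$-strongly connected graph sequence has mixing constants $\delta,\lambda$ with $\delta\ge m^{-mB}$ and $\lambda\le\bigl(1-m^{-mB}\bigr)^{1/(mB)}$, $\lambda<1$. 2. There is a finite constant $D_0$, depending only on $m,B,d,(U_i),L,\mu,\alpha(0),\sigma,\rho$ and $(X_{(i)}(0))$, such that every $e_i(s)$ is integrable and $\mathbb E\|e_i(s)\|\le D_0/\sqrt s$ for all $i$ and all $s\ge1$. 3. For every constant $D$ with $\mathbb E\|e_i(s)\|\le D/\sqrt s$ for all $i$ and all $s\ge 1$ (in particular for $D=D_0$), all mixing constants $\delta,\lambda$ of the graph sequence, every agent $i$ and every $\tau\ge0$, the errors $Z_{(i)}(t+1)-\bar X(t)$ ($1\le t\le \tau$) are integrable and $$\mathbb E\Bigl[\sum_{t=1}^{\tau}\bigl\|Z_{(i)}(t+1)-\bar X(t)\bigr\|\Bigr]\le\frac8\delta\,\frac{\lambda}{1-\lambda}\sum_{j=1}^m\|X_{(j)}(0)\|_1+\frac8\delta\,\frac{Dm}{1-\lambda}\,\bigl(1+\sqrt\tau\bigr).$$ -/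

import Mathlib

open MeasureTheory ProbabilityTheory

noncomputable section

namespace PushLangevin

/-! ### Time-varying directed graphs and the push-sum mixing matrices -/

/-- In-neighbours of `i`, the node itself included. -/
def inNbhd {m : ℕ} (H : Digraph (Fin m)) (i : Fin m) : Set (Fin m) :=
  {j | H.Adj j i} ∪ {i}

/-- Out-neighbours of `i`, the node itself included. -/
def outNbhd {m : ℕ} (H : Digraph (Fin m)) (i : Fin m) : Set (Fin m) :=
  {j | H.Adj i j} ∪ {i}

/-- The out-degree `d_i`, which counts the node itself. -/
def outDeg {m : ℕ} (H : Digraph (Fin m)) (i : Fin m) : ℕ :=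
  (outNbhd H i).ncard

open Classical in
/-- The column-stochastic mixing matrix: `A i j = 1 / d_j` if `j` is an in-neighbour of `i`,
and `0` otherwise. -/
def mixMatrix {m : ℕ} (H : Digraph (Fin m)) : Matrix (Fin m) (Fin m) ℝ :=
  fun i j => if j ∈ inNbhd H i then 1 / (outDeg H j : ℝ) else 0

/-- Every union of the edge sets over a window `kB, …, (k+1)B - 1` is strongly connected. -/
def BStronglyConnected {m : ℕ} (G : ℕ → Digraph (Fin m)) (B : ℕ) : Prop :=
  ∀ k : ℕ, ∀ i j : Fin m,
    Relation.ReflTransGen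
      (fun a b => ∃ t, k * B ≤ t ∧ t < (k + 1) * B ∧ (G t).Adj a b) i j

/-- `transition G s n` is the product `A(s+n-1) ⋯ A(s+1) A(s)` of `n` mixing matrices. -/
def transition {m : ℕ} (G : ℕ → Digraph (Fin m)) (s : ℕ) : ℕ → Matrix (Fin m) (Fin m) ℝ
  | 0 => 1
  | n + 1 => mixMatrix (G (s + n)) * transition G s n

/-- `δ` and `lam` are mixing constants of the graph sequence: `δ > 0` bounds every entry of
`A(t) ⋯ A(0) 1` from below, and `lam ∈ [0,1)` is a geometric rate at which the columns of
`A(t) ⋯ A(s)` approach a common stochastic vector `φ(t)`, namely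
`|(A(t) ⋯ A(s))_{ij} - φ_i(t)| ≤ 4 lam ^ (t - s)` for `t = s + n ≥ s`. -/
structure IsMixingConstants {m : ℕ} (G : ℕ → Digraph (Fin m)) (δ lam : ℝ) : Prop where
  delta_pos : 0 < δ
  delta_le : ∀ (t : ℕ) (i : Fin m), δ ≤ ∑ j, transition G 0 (t + 1) i j
  lam_nonneg : 0 ≤ lam
  lam_lt_one : lam < 1
  mixing : ∃ φ : ℕ → Fin m → ℝ,
    (∀ t, (∀ i, 0 ≤ φ t i) ∧ ∑ i, φ t i = 1) ∧
    ∀ (s n : ℕ) (i j : Fin m), |transition G s (n + 1) i j - φ (s + n) i| ≤ 4 * lam ^ n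

/-! ### The algorithm -/

/-- The step size `α(t) = α(0) / (1 + t)`. -/
def stepSize (α₀ : ℝ) (t : ℕ) : ℝ := α₀ / (1 + t)

/-- The balancing weights: `Y(0) = 1`, `Y(t+1) = A(t) Y(t)`. -/
def weightY {m : ℕ} (G : ℕ → Digraph (Fin m)) : ℕ → Fin m → ℝ
  | 0 => fun _ => 1
  | t + 1 => fun i => ∑ j, mixMatrix (G t) i j * weightY G t j

/-- The consensus step `A X`, for a stack `X` of vectors of `ℝᵈ`. -/
def consensus {m d : ℕ} (H : Digraph (Fin m)) (X : Fin m → EuclideanSpace ℝ (Fin d)) :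
    Fin m → EuclideanSpace ℝ (Fin d) :=
  fun i => ∑ j, mixMatrix H i j • X j

/-- `Z(t+1) = (A(t) X(t)) ⊘ (A(t) Y(t))`, from the stack `X = X(t)`. -/
def balanced {m d : ℕ} (G : ℕ → Digraph (Fin m)) (t : ℕ)
    (X : Fin m → EuclideanSpace ℝ (Fin d)) : Fin m → EuclideanSpace ℝ (Fin d) :=
  fun i => (weightY G (t + 1) i)⁻¹ • consensus (G t) X i

/-- The perturbation at time `t` of agent `i`: `-α(t) ∇U_i(z) + √(2 α(t)) b`. -/
def perturb {d : ℕ} (α₀ : ℝ) (f : EuclideanSpace ℝ (Fin d) → ℝ) (t : ℕ)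
    (z b : EuclideanSpace ℝ (Fin d)) : EuclideanSpace ℝ (Fin d) :=
  -(stepSize α₀ t • gradient f z) + Real.sqrt (2 * stepSize α₀ t) • b

/-- The iterates `X(t)`, started at `x₀` and driven by the noise sequence `b`:
`X(t+1) = A(t) X(t) - α(t+1) ∇U(Z(t+1)) + √(2 α(t+1)) b(t+1)`. -/
def iterX {m d : ℕ} (G : ℕ → Digraph (Fin m)) (U : Fin m → EuclideanSpace ℝ (Fin d) → ℝ)
    (α₀ : ℝ) (x₀ : Fin m → EuclideanSpace ℝ (Fin d))
    (b : ℕ → Fin m → EuclideanSpace ℝ (Fin d)) : ℕ → Fin m → EuclideanSpace ℝ (Fin d)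
  | 0 => x₀
  | t + 1 => fun i =>
      consensus (G t) (iterX G U α₀ x₀ b t) i +
        perturb α₀ (U i) (t + 1) (balanced G t (iterX G U α₀ x₀ b t) i) (b (t + 1) i)

/-- The balanced averages `Z(t)`, with `Z(0) = 0`. -/
def iterZ {m d : ℕ} (G : ℕ → Digraph (Fin m)) (U : Fin m → EuclideanSpace ℝ (Fin d) → ℝ)
    (α₀ : ℝ) (x₀ : Fin m → EuclideanSpace ℝ (Fin d))
    (b : ℕ → Fin m → EuclideanSpace ℝ (Fin d)) : ℕ → Fin m → EuclideanSpace ℝ (Fin d)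
  | 0 => 0
  | t + 1 => balanced G t (iterX G U α₀ x₀ b t)

/-- The network average `X̄(t)`. -/
def avgX {m d : ℕ} (G : ℕ → Digraph (Fin m)) (U : Fin m → EuclideanSpace ℝ (Fin d) → ℝ)
    (α₀ : ℝ) (x₀ : Fin m → EuclideanSpace ℝ (Fin d))
    (b : ℕ → Fin m → EuclideanSpace ℝ (Fin d)) (t : ℕ) : EuclideanSpace ℝ (Fin d) :=
  (m : ℝ)⁻¹ • ∑ i, iterX G U α₀ x₀ b t i

/-- The perturbation `e_i(t)` that enters `X_i(t)`, for `t ≥ 1`. -/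
def iterE {m d : ℕ} (G : ℕ → Digraph (Fin m)) (U : Fin m → EuclideanSpace ℝ (Fin d) → ℝ)
    (α₀ : ℝ) (x₀ : Fin m → EuclideanSpace ℝ (Fin d))
    (b : ℕ → Fin m → EuclideanSpace ℝ (Fin d)) (t : ℕ) (i : Fin m) :
    EuclideanSpace ℝ (Fin d) :=
  perturb α₀ (U i) t (iterZ G U α₀ x₀ b t i) (b t i)

/-! ### The noise -/

/-- The noise `B_i(t) = √α(t) ξ_i(t) + R_i(t)`. -/
def noise {m d : ℕ} {Ω : Type*} (α₀ : ℝ) (ξ R : ℕ → Fin m → Ω → EuclideanSpace ℝ (Fin d))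
    (ω : Ω) (t : ℕ) (i : Fin m) : EuclideanSpace ℝ (Fin d) :=
  Real.sqrt (stepSize α₀ t) • ξ t i ω + R t i ω

/-- The assumptions on the two noise sources relative to a filtration `ℱ` (the history):
`ξ_i(t+1)` is a stochastic gradient error that has conditional mean zero given the past and
second moment at most `σ²`, and `R_i(t+1)` is independent of the past and isotropic Gaussian with
mean `0` and covariance `ρ² I`. No dependence structure between different agents, or between
`ξ_i(t+1)` and `R_i(t+1)`, is imposed. -/
structure IsNoise {m d : ℕ} {Ω : Type*} [MeasurableSpace Ω] (P : Measure Ω)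
    (ℱ : Filtration ℕ ‹MeasurableSpace Ω›) (σ ρ : ℝ)
    (ξ R : ℕ → Fin m → Ω → EuclideanSpace ℝ (Fin d)) : Prop where
  measurable_error : ∀ t i, Measurable[ℱ (t + 1)] (ξ (t + 1) i)
  memLp_error : ∀ t i, MemLp (ξ (t + 1) i) 2 P
  unbiased : ∀ t i, P[ξ (t + 1) i | ℱ t] =ᵐ[P] 0
  variance_le : ∀ t i, ∫ ω, ‖ξ (t + 1) i ω‖ ^ 2 ∂P ≤ σ ^ 2
  measurable_gauss : ∀ t i, Measurable[ℱ (t + 1)] (R (t + 1) i)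
  law_gauss : ∀ t i, P.map (R (t + 1) i) =
    (stdGaussian (EuclideanSpace ℝ (Fin d))).map (fun x => ρ • x)
  indep_gauss : ∀ t i,
    Indep (MeasurableSpace.comap (R (t + 1) i) inferInstance) (ℱ t) P

end PushLangevin

end

namespace PushLangevin

/-! ### Products of mixing matrices -/

/-! Every nonzero entry of a mixing matrix is at least `1/m`, and the diagonal is nonzero, so any
product of `m * B` consecutive matrices has all entries at least `η = m^(-mB)`
(`BStronglyConnected.le_transition`). Columns of the first block act as averaging weights on the
rows of the later product, so each block shrinks the spread within a row by `1 - η`. This gives the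
mixing constants.

For the perturbations, the invariant is `E‖X_i(t)‖ ≤ Y_i(t) v(t)`. Since `Y(t+1) = A(t) Y(t)`,
averaging turns it into `E‖Z_i(t+1)‖ ≤ v(t)`. Relative to `Z`, the update is a gradient step of
length `α/Y`. The gradients are monotone, so such a step expands norms by only `1 + O(α²)`, and `∑
α²` converges; the noise adds `O(1/√t)` per step. Hence `v(t) = O(√t)` and `E‖e_i(t)‖ ≤ α(t) O(√t) +
O(√α(t)) = O(1/√t)`.

For the consensus error, unrolling the recursion writes `Z_i(t+1) - X̄(t)` as a sum of past
perturbations, the initial state counting as the one at time `0`, with coefficients at most `min 1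
(8 lam^(t-s)) / δ` (`IsMixingConstants.abs_coeff_le`). The cap at `1` matters: it lowers the
geometric sum from `8/(1-lam)` to `4/(1-lam)`, which offsets the `2` in `∑ 1/√s ≤ 2√τ` and leaves
the constant `8`. -/

lemma outDeg_pos {m : ℕ} (H : Digraph (Fin m)) (j : Fin m) : 0 < outDeg H j := by
  rw [outDeg, Set.ncard_pos]
  exact ⟨j, Or.inr rfl⟩

lemma outDeg_le {m : ℕ} (H : Digraph (Fin m)) (j : Fin m) : outDeg H j ≤ m := by
  simpa [outDeg] using Set.ncard_le_card (outNbhd H j)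

lemma mixMatrix_nonneg {m : ℕ} (H : Digraph (Fin m)) (i j : Fin m) : 0 ≤ mixMatrix H i j := by
  unfold mixMatrix
  split_ifs <;> positivity

lemma le_mixMatrix {m : ℕ} (H : Digraph (Fin m)) {i j : Fin m} (h : j ∈ inNbhd H i) :
    1 / (m : ℝ) ≤ mixMatrix H i j := by
  rw [mixMatrix, if_pos h]
  exact one_div_le_one_div_of_le (by exact_mod_cast outDeg_pos H j)
    (by exact_mod_cast outDeg_le H j)

lemma sum_mixMatrix {m : ℕ} (H : Digraph (Fin m)) (j : Fin m) :
    ∑ i, mixMatrix H i j = 1 := by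
  classical
  have h : {i : Fin m | j ∈ inNbhd H i} = outNbhd H j := by
    ext i
    simp [inNbhd, outNbhd, eq_comm]
  have hc : (Finset.univ.filter fun i : Fin m => j ∈ inNbhd H i).card = outDeg H j := by
    rw [outDeg, ← h, Set.ncard_eq_toFinset_card']
    congr 1
    ext i
    simp
  have h0 : (outDeg H j : ℝ) ≠ 0 := by exact_mod_cast (outDeg_pos H j).ne'
  simp only [mixMatrix]
  rw [← Finset.sum_filter, Finset.sum_const, nsmul_eq_mul]
  have hc' : ((Finset.univ.filter fun i : Fin m => j ∈ inNbhd H i).card : ℝ) = outDeg H j := by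
    exact_mod_cast hc
  convert mul_one_div_cancel h0 using 2

lemma transition_nonneg {m : ℕ} (G : ℕ → Digraph (Fin m)) (s n : ℕ) (i j : Fin m) :
    0 ≤ transition G s n i j := by
  induction n generalizing i with
  | zero =>
    rw [transition, Matrix.one_apply]
    split_ifs <;> norm_num
  | succ n ih =>
    rw [transition, Matrix.mul_apply]
    exact Finset.sum_nonneg fun k _ => mul_nonneg (mixMatrix_nonneg _ _ _) (ih k)

lemma sum_transition {m : ℕ} (G : ℕ → Digraph (Fin m)) (s n : ℕ) (j : Fin m) :
    ∑ i, transition G s n i j = 1 := by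
  induction n with
  | zero => simp [transition, Matrix.one_apply]
  | succ n ih =>
    simp only [transition, Matrix.mul_apply]
    rw [Finset.sum_comm]
    simp_rw [← Finset.sum_mul, sum_mixMatrix, one_mul]
    exact ih

lemma transition_le_one {m : ℕ} (G : ℕ → Digraph (Fin m)) (s n : ℕ) (i j : Fin m) :
    transition G s n i j ≤ 1 := by
  rw [← sum_transition G s n j]
  exact Finset.single_le_sum (f := fun i => transition G s n i j)
    (fun k _ => transition_nonneg G s n k j) (Finset.mem_univ i)

lemma transition_add {m : ℕ} (G : ℕ → Digraph (Fin m)) (s a b : ℕ) :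
    transition G s (a + b) = transition G (s + a) b * transition G s a := by
  induction b with
  | zero => simp [transition]
  | succ b ih =>
    rw [← add_assoc, transition, ih, transition, Matrix.mul_assoc, add_assoc s]

lemma le_transition_succ {m : ℕ} (G : ℕ → Digraph (Fin m)) {s n : ℕ} {i k j : Fin m}
    (hk : k ∈ inNbhd (G (s + n)) i) (h : (1 / (m : ℝ)) ^ n ≤ transition G s n k j) :
    (1 / (m : ℝ)) ^ (n + 1) ≤ transition G s (n + 1) i j := by
  rw [transition, Matrix.mul_apply, pow_succ']
  calc 1 / (m : ℝ) * (1 / (m : ℝ)) ^ n ≤ mixMatrix (G (s + n)) i k * transition G s n k j :=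
        mul_le_mul (le_mixMatrix _ hk) h (by positivity) (mixMatrix_nonneg _ _ _)
    _ ≤ _ := Finset.single_le_sum
        (f := fun k => mixMatrix (G (s + n)) i k * transition G s n k j)
        (fun k _ => mul_nonneg (mixMatrix_nonneg _ _ _) (transition_nonneg _ _ _ _ _))
        (Finset.mem_univ k)

/-- A set that is propagated along the edges of a `B`-strongly connected sequence fills the whole
graph within `m * B` steps. -/
lemma BStronglyConnected.propagate {m B : ℕ} {G : ℕ → Digraph (Fin m)}
    (hG : BStronglyConnected G B) (hm : 0 < m) (hB : 0 < B) {s : ℕ} {S : ℕ → Set (Fin m)}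
    (hne : (S s).Nonempty) (hmono : ∀ r, s ≤ r → S r ⊆ S (r + 1))
    (hedge : ∀ r, s ≤ r → ∀ a b, a ∈ S r → (G r).Adj a b → b ∈ S (r + 1)) :
    S (s + m * B) = Set.univ := by
  have hsub : ∀ a n, s ≤ a → S a ⊆ S (a + n) := by
    intro a n ha
    induction n with
    | zero => exact subset_rfl
    | succ n ih => exact ih.trans (hmono (a + n) (by omega))
  have hsub' : ∀ a b, s ≤ a → a ≤ b → S a ⊆ S b := by
    intro a b ha hab
    obtain ⟨n, rfl⟩ := Nat.exists_eq_add_of_le hab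
    exact hsub a n ha
  -- A set that does not grow during a full window is closed under all edges of that window, so
  -- strong connectivity makes it everything.
  have hstep : ∀ k, s ≤ k * B → S ((k + 1) * B) = S (k * B) → S (k * B) = Set.univ := by
    intro k hk heq
    obtain ⟨a, ha⟩ := (hne.mono (hsub' s _ le_rfl hk))
    refine Set.eq_univ_of_forall fun b => ?_
    have hp := hG k a b
    induction hp with
    | refl => exact ha
    | tail _ hbc ih =>
      obtain ⟨t, ht1, ht2, hadj⟩ := hbc
      rw [← heq]
      exact hsub' (t + 1) _ (by omega) ht2
        (hedge t (by omega) _ _ (hsub' _ _ hk ht1 ih) hadj)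
  -- The time `s` may fall inside a window; the first one certain to start no earlier than `s` has
  -- index `s / B + 1`. From one vertex, `m - 1` windows suffice, and the last ends by `s + m * B`.
  have hk0 : s ≤ (s / B + 1) * B := by
    have := Nat.lt_div_mul_add (a := s) hB
    rw [add_mul]; omega
  have hge : ∀ i, s ≤ (s / B + 1 + i) * B := fun i =>
    hk0.trans (Nat.mul_le_mul_right _ (by omega))
  have hgrow : ∀ i, S ((s / B + 1 + i) * B) = Set.univ ∨
      i + 1 ≤ (S ((s / B + 1 + i) * B)).ncard := by
    intro i
    induction i with
    | zero =>
      right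
      exact (Set.ncard_pos).2 (hne.mono (hsub' s _ le_rfl hk0))
    | succ i ih =>
      have hincl : S ((s / B + 1 + i) * B) ⊆ S ((s / B + 1 + i + 1) * B) :=
        hsub' _ _ (hge i) (Nat.mul_le_mul_right _ (by omega))
      rw [← add_assoc (s / B + 1)]
      rcases ih with h | h
      · left
        exact Set.univ_subset_iff.1 (h ▸ hincl)
      · by_cases heq : S ((s / B + 1 + i + 1) * B) = S ((s / B + 1 + i) * B)
        · left
          rw [heq]
          exact hstep _ (hge i) heq
        · right
          have := Set.ncard_lt_ncard (hincl.ssubset_of_ne (Ne.symm heq))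
          omega
  have hlast : S ((s / B + 1 + (m - 1)) * B) = Set.univ := by
    rcases hgrow (m - 1) with h | h
    · exact h
    · refine Set.eq_of_subset_of_ncard_le (Set.subset_univ _) ?_
      rw [Set.ncard_univ, Nat.card_eq_fintype_card, Fintype.card_fin]
      omega
  refine Set.univ_subset_iff.1 (hlast ▸ hsub' _ _ (hge _) ?_)
  have h1 : s / B * B ≤ s := Nat.div_mul_le_self s B
  have h2 : s / B + 1 + (m - 1) = s / B + m := by omega
  rw [h2, add_mul]
  omega

lemma BStronglyConnected.le_transition {m B : ℕ} {G : ℕ → Digraph (Fin m)}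
    (hG : BStronglyConnected G B) (hm : 0 < m) (hB : 0 < B) (s : ℕ) (i j : Fin m) :
    1 / (m : ℝ) ^ (m * B) ≤ transition G s (m * B) i j := by
  have h := hG.propagate hm hB (s := s)
    -- The propagated set consists of the nodes whose entry in column `j` is at least `m^(-n)` after
    -- `n` steps.
    (S := fun r => {i | (1 / (m : ℝ)) ^ (r - s) ≤ transition G s (r - s) i j})
    ⟨j, by simp [transition]⟩ ?_ ?_
  · have hi : i ∈ (Set.univ : Set (Fin m)) := trivial
    rw [← h] at hi
    simpa using hi
  · intro r hr a ha
    obtain ⟨n, rfl⟩ := Nat.exists_eq_add_of_le hr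
    simp only [Set.mem_ofPred_eq, Nat.add_sub_cancel_left, add_assoc] at ha ⊢
    exact le_transition_succ G (Or.inr rfl) ha
  · intro r hr a b ha hadj
    obtain ⟨n, rfl⟩ := Nat.exists_eq_add_of_le hr
    simp only [Set.mem_ofPred_eq, Nat.add_sub_cancel_left, add_assoc] at ha ⊢
    exact le_transition_succ G (Or.inl hadj) ha

lemma le_transition_self {m : ℕ} (G : ℕ → Digraph (Fin m)) (s n : ℕ) (i : Fin m) :
    (1 / (m : ℝ)) ^ n ≤ transition G s n i i := by
  induction n with
  | zero => simp [transition]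
  | succ n ih => exact le_transition_succ G (Or.inr rfl) ih

lemma BStronglyConnected.le_sum_transition {m B : ℕ} {G : ℕ → Digraph (Fin m)}
    (hG : BStronglyConnected G B) (hm : 0 < m) (hB : 0 < B) (n : ℕ) (i : Fin m) :
    1 / (m : ℝ) ^ (m * B) ≤ ∑ j, transition G 0 n i j := by
  have hm1 : (1 : ℝ) ≤ m := by exact_mod_cast hm
  suffices h : 1 / (m : ℝ) ^ (m * B) ≤ transition G 0 n i i from
    h.trans (Finset.single_le_sum (f := fun j => transition G 0 n i j)
      (fun k _ => transition_nonneg G 0 n i k) (Finset.mem_univ i))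
  rcases le_total n (m * B) with h | h
  -- Short products are controlled by their diagonal. Long ones end in a full block with entries at
  -- least `m^(-mB)`, applied to a column of total mass `1`.
  · refine le_trans ?_ (le_transition_self G 0 n i)
    rw [one_div_pow]
    exact one_div_le_one_div_of_le (by positivity) (pow_le_pow_right₀ hm1 h)
  · obtain ⟨a, rfl⟩ := Nat.exists_eq_add_of_le' h
    rw [transition_add, Matrix.mul_apply]
    calc 1 / (m : ℝ) ^ (m * B) = ∑ k, 1 / (m : ℝ) ^ (m * B) * transition G 0 a k i := by
          rw [← Finset.mul_sum, sum_transition, mul_one]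
      _ ≤ _ := Finset.sum_le_sum fun k _ =>
          mul_le_mul_of_nonneg_right (hG.le_transition hm hB _ _ _) (transition_nonneg _ _ _ _ _)

/-- Averaging with stochastic weights that are at least `η` contracts the oscillation of a
vector by the factor `1 - η`. -/
lemma sum_mul_sub_sum_mul_le {ι : Type*} [Fintype ι] {η c : ℝ} {v p q : ι → ℝ}
    (hv : ∀ j k, v j - v k ≤ c) (hc : 0 ≤ c) (hp : ∀ k, η ≤ p k) (hp0 : ∀ k, 0 ≤ p k)
    (hps : ∑ k, p k = 1) (hq0 : ∀ k, 0 ≤ q k) (hqs : ∑ k, q k = 1) :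
    ∑ k, v k * p k - ∑ k, v k * q k ≤ (1 - η) * c := by
  classical
  have hne : Nonempty ι := by
    by_contra h
    rw [not_nonempty_iff] at h
    simp at hps
  obtain ⟨k₀, hk₀⟩ := Finite.exists_min v
  -- Every value is at most the minimum plus `c`, and the minimiser, of mass at least `η`, saves a
  -- further `c`.
  have h1 : ∑ k, v k * p k ≤ ∑ k, ((v k₀ + c) * p k - if k = k₀ then c * p k else 0) := by
    refine Finset.sum_le_sum fun k _ => ?_
    split_ifs with h
    · subst h; linarith
    · nlinarith [hv k k₀, hp0 k]
  rw [Finset.sum_sub_distrib, ← Finset.mul_sum, hps, Finset.sum_ite_eq' _ k₀] at h1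
  simp only [Finset.mem_univ, if_true] at h1
  have h2 : ∑ k, v k₀ * q k ≤ ∑ k, v k * q k :=
    Finset.sum_le_sum fun k _ => mul_le_mul_of_nonneg_right (hk₀ k) (hq0 k)
  rw [← Finset.mul_sum, hqs] at h2
  nlinarith [hp k₀]

lemma BStronglyConnected.transition_sub_le {m B : ℕ} {G : ℕ → Digraph (Fin m)}
    (hG : BStronglyConnected G B) (hm : 0 < m) (hB : 0 < B) (q r s : ℕ) (i j k : Fin m) :
    transition G s (q * (m * B) + r) i j - transition G s (q * (m * B) + r) i k
      ≤ (1 - 1 / (m : ℝ) ^ (m * B)) ^ q := by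
  have hm1 : (1 : ℝ) ≤ m := by exact_mod_cast hm
  have hη : 1 / (m : ℝ) ^ (m * B) ≤ 1 := by
    rw [div_le_one (by positivity)]
    exact one_le_pow₀ hm1
  induction q generalizing s j k with
  | zero =>
    simp only [zero_mul, zero_add, pow_zero]
    linarith [transition_le_one G s r i j, transition_nonneg G s r i k]
  | succ q ih =>
    -- The block is peeled off at the early end, so the row `i` stays fixed and the columns `j`, `k`
    -- of that block become the weights.
    have he : (q + 1) * (m * B) + r = m * B + (q * (m * B) + r) := by ring
    rw [he, transition_add, Matrix.mul_apply, Matrix.mul_apply, pow_succ']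
    exact sum_mul_sub_sum_mul_le (fun j k => ih (s + m * B) j k)
      (pow_nonneg (by linarith) _) (fun l => hG.le_transition hm hB s l j)
      (fun l => transition_nonneg _ _ _ _ _) (sum_transition _ _ _ _)
      (fun l => transition_nonneg _ _ _ _ _) (sum_transition _ _ _ _)

lemma BStronglyConnected.abs_transition_sub_le {m B : ℕ} {G : ℕ → Digraph (Fin m)}
    (hG : BStronglyConnected G B) (hm : 0 < m) (hB : 0 < B) (s n : ℕ) (i j k : Fin m) :
    |transition G s (n + 1) i j - transition G s (n + 1) i k|
      ≤ 4 * ((1 - 1 / (m : ℝ) ^ (m * B)) ^ (1 / ((m : ℝ) * (B : ℝ)))) ^ n := by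
  -- For `m = 1` the factor `1 - η` vanishes, but there is only one column. For `m ≥ 2` it is at
  -- least `1/2`.
  rcases (show m = 1 ∨ 2 ≤ m by omega) with rfl | hm2
  · rw [Subsingleton.elim j k, sub_self, abs_zero]
    simp
    positivity
  have hmB : 0 < m * B := Nat.mul_pos hm hB
  set η : ℝ := 1 / (m : ℝ) ^ (m * B) with hη
  have hη4 : η ≤ 1 / 2 := by
    refine one_div_le_one_div_of_le (by norm_num) ?_
    calc (2 : ℝ) ≤ m := by exact_mod_cast hm2
      _ ≤ (m : ℝ) ^ (m * B) := le_self_pow₀ (by exact_mod_cast hm) hmB.ne'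
  have hη0 : 0 ≤ η := by positivity
  have hdm := Nat.div_add_mod' (n + 1) (m * B)
  have hlt := Nat.mod_lt (n + 1) hmB
  have key : |transition G s (n + 1) i j - transition G s (n + 1) i k|
      ≤ (1 - η) ^ ((n + 1) / (m * B)) := by
    rw [abs_sub_le_iff]
    constructor
    · have := hG.transition_sub_le hm hB ((n + 1) / (m * B)) ((n + 1) % (m * B)) s i j k
      rwa [hdm] at this
    · have := hG.transition_sub_le hm hB ((n + 1) / (m * B)) ((n + 1) % (m * B)) s i k j
      rwa [hdm] at this
  -- One block more than those completed covers `n` steps; undoing that extra factor costs at most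
  -- `2`, within the allowed `4`.
  have hpow : (1 - η) ^ ((n + 1) / (m * B) + 1) ≤
      ((1 - η) ^ (1 / ((m : ℝ) * (B : ℝ)))) ^ n := by
    rw [← Real.rpow_mul_natCast (by linarith), ← Real.rpow_natCast]
    refine Real.rpow_le_rpow_of_exponent_ge (by linarith) (by linarith) ?_
    have hmB' : (0 : ℝ) < (m : ℝ) * B := by exact_mod_cast hmB
    rw [one_div_mul_eq_div, div_le_iff₀ hmB']
    have : n ≤ ((n + 1) / (m * B) + 1) * (m * B) := by rw [add_mul]; omega
    exact_mod_cast this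
  have h0 : 0 ≤ (1 - η) ^ ((n + 1) / (m * B)) := pow_nonneg (by linarith) _
  rw [pow_succ] at hpow
  nlinarith

theorem BStronglyConnected.isMixingConstants {m B : ℕ} {G : ℕ → Digraph (Fin m)}
    (hG : BStronglyConnected G B) (hm : 0 < m) (hB : 0 < B) :
    IsMixingConstants G (1 / (m : ℝ) ^ (m * B))
      ((1 - 1 / (m : ℝ) ^ (m * B)) ^ (1 / ((m : ℝ) * (B : ℝ)))) := by
  have hm1 : (1 : ℝ) ≤ m := by exact_mod_cast hm
  have hm0 : (m : ℝ) ≠ 0 := by positivity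
  have hη : 1 / (m : ℝ) ^ (m * B) ≤ 1 := by
    rw [div_le_one (by positivity)]
    exact one_le_pow₀ hm1
  have hB0 : (0 : ℝ) < B := by exact_mod_cast hB
  have hη0 : 0 < 1 / (m : ℝ) ^ (m * B) := by positivity
  -- The limit vector `φ(t)` is the image of the uniform vector. For every start `s` it is a
  -- weighted average of the columns of the product from `s`, with weights `w` independent of the
  -- later factors, so the column spread bounds the distance to it.
  refine ⟨hη0, fun t i => hG.le_sum_transition hm hB (t + 1) i,
    Real.rpow_nonneg (by linarith) _, Real.rpow_lt_one (by linarith) (by linarith)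
      (by positivity), fun t i => ∑ k, transition G 0 (t + 1) i k * (m : ℝ)⁻¹, ?_, ?_⟩
  · refine fun t => ⟨fun i => Finset.sum_nonneg fun k _ =>
      mul_nonneg (transition_nonneg _ _ _ _ _) (by positivity), ?_⟩
    rw [Finset.sum_comm]
    simp_rw [← Finset.sum_mul, sum_transition]
    simp [hm0]
  · intro s n i j
    set w : Fin m → ℝ := fun l => ∑ k, transition G 0 s l k * (m : ℝ)⁻¹ with hw
    have hw0 : ∀ l, 0 ≤ w l := fun l => Finset.sum_nonneg fun k _ =>
      mul_nonneg (transition_nonneg _ _ _ _ _) (by positivity)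
    have hws : ∑ l, w l = 1 := by
      simp only [hw]
      rw [Finset.sum_comm]
      simp_rw [← Finset.sum_mul, sum_transition]
      simp [hm0]
    have h1 : ∑ k, transition G 0 (s + n + 1) i k * (m : ℝ)⁻¹
        = ∑ l, transition G s (n + 1) i l * w l := by
      rw [add_assoc, transition_add, zero_add]
      simp only [Matrix.mul_apply, hw, Finset.mul_sum, Finset.sum_mul]
      rw [Finset.sum_comm]
      simp only [mul_assoc]
    have h2 : transition G s (n + 1) i j = ∑ l, transition G s (n + 1) i j * w l := by
      rw [← Finset.mul_sum, hws, mul_one]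
    beta_reduce
    rw [h1, h2, ← Finset.sum_sub_distrib]
    refine (Finset.abs_sum_le_sum_abs _ _).trans ?_
    refine (Finset.sum_le_sum fun l _ => ?_).trans
      (by rw [← Finset.mul_sum, hws, mul_one] :
        ∑ l, (4 * ((1 - 1 / (m : ℝ) ^ (m * B)) ^ (1 / ((m : ℝ) * (B : ℝ)))) ^ n) * w l ≤ _)
    · rw [← sub_mul, abs_mul, abs_of_nonneg (hw0 l)]
      exact mul_le_mul_of_nonneg_right (hG.abs_transition_sub_le hm hB s n i j l) (hw0 l)

/-! ### The deviation of the balanced averages from the network average -/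

/-- Removing the first term replaces `y` by `y * lam`. The bound is chosen so that this lowers its
numerator by at least `(1 - lam) * min 1 y`; above `1` this rests on `log x ≤ x - 1` and `1 - 1/x ≤
log x`. -/
lemma sum_min_one_geometric_le {lam : ℝ} (h0 : 0 ≤ lam) (h1 : lam < 1) (N : ℕ) {y : ℝ}
    (hy : 0 ≤ y) :
    ∑ n ∈ Finset.range N, min 1 (y * lam ^ n)
      ≤ (if y ≤ 1 then y else 1 + Real.log y) / (1 - lam) := by
  have hpos : 0 < 1 - lam := by linarith
  induction N generalizing y with
  | zero =>
    rw [Finset.sum_range_zero]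
    refine div_nonneg ?_ hpos.le
    split_ifs with h
    · exact hy
    · linarith [Real.log_nonneg (not_le.1 h).le]
  | succ N ih =>
    rw [Finset.sum_range_succ']
    have hs := ih (mul_nonneg hy h0)
    simp only [mul_assoc, ← pow_succ'] at hs
    rw [pow_zero, mul_one]
    refine (add_le_add_left hs _).trans ?_
    rw [div_add' _ _ _ hpos.ne', div_le_div_iff_of_pos_right hpos]
    by_cases hy1 : y ≤ 1
    · have : y * lam ≤ 1 := by nlinarith
      rw [if_pos hy1, if_pos this, min_eq_right hy1]
      linarith
    · rw [if_neg hy1]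
      push Not at hy1
      have hy0 : 0 < y := by linarith
      rw [min_eq_left hy1.le]
      split_ifs with h
      · have h2 := Real.one_sub_inv_le_log_of_pos hy0
        have h3 : lam ≤ y⁻¹ := by rwa [← one_div, le_div_iff₀' hy0]
        have h4 : y * y⁻¹ = 1 := mul_inv_cancel₀ hy0.ne'
        nlinarith
      · have hl : 0 < lam := by
          rcases h0.eq_or_lt with h' | h'
          · rw [← h'] at h; norm_num at h
          · exact h'
        rw [Real.log_mul hy0.ne' hl.ne']
        linarith [Real.log_le_sub_one_of_pos hl]

lemma sum_min_one_eight_mul_pow_le {lam : ℝ} (h0 : 0 ≤ lam) (h1 : lam < 1) (N : ℕ) :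
    ∑ n ∈ Finset.range N, min 1 (8 * lam ^ n) ≤ 4 / (1 - lam) := by
  refine (sum_min_one_geometric_le h0 h1 N (by norm_num)).trans ?_
  -- The numerator is `1 + 3 log 2`, about `3.08`.
  rw [if_neg (by norm_num), div_le_div_iff_of_pos_right (by linarith),
    show (8 : ℝ) = 2 ^ 3 by norm_num, Real.log_pow]
  push_cast
  linarith [Real.log_two_lt_d9]

lemma two_mul_sqrt_add_inv_sqrt_le (t : ℕ) :
    2 * Real.sqrt t + 1 / Real.sqrt ((t + 1 : ℕ) : ℝ) ≤ 2 * Real.sqrt ((t + 1 : ℕ) : ℝ) := by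
  have h1 := Real.sq_sqrt (Nat.cast_nonneg (α := ℝ) t)
  have h2 := Real.sq_sqrt (Nat.cast_nonneg (α := ℝ) (t + 1))
  have hp : 0 < Real.sqrt ((t + 1 : ℕ) : ℝ) := Real.sqrt_pos.2 (by positivity)
  rw [← le_sub_iff_add_le', div_le_iff₀ hp]
  push_cast at *
  nlinarith [sq_nonneg (Real.sqrt ((t : ℝ) + 1) - Real.sqrt t)]

lemma sum_inv_sqrt_le (τ : ℕ) :
    ∑ s ∈ Finset.Icc 1 τ, 1 / Real.sqrt (s : ℝ) ≤ 2 * Real.sqrt τ := by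
  induction τ with
  | zero => simp
  | succ τ ih =>
    rw [Finset.sum_Icc_succ_top (by omega)]
    linarith [two_mul_sqrt_add_inv_sqrt_le τ]

lemma sum_convolution_le {lam M : ℝ} (h0 : 0 ≤ lam) (h1 : lam < 1) {a : ℕ → ℝ}
    (ha0 : 0 ≤ a 0) (ha : ∀ s, 1 ≤ s → a s ≤ M / Real.sqrt s) (hM : 0 ≤ M) (τ : ℕ) :
    ∑ t ∈ Finset.Icc 1 τ, ∑ s ∈ Finset.range (t + 1), min 1 (8 * lam ^ (t - s)) * a s
      ≤ 8 * (lam / (1 - lam)) * a 0 + 8 * (M / (1 - lam)) * Real.sqrt τ := by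
  have hpos : 0 < 1 - lam := by linarith
  -- The term `s = 0` carries the initial state, which has no `1/√s` bound, and is summed as a plain
  -- geometric series from `t = 1`.
  have hsplit : ∀ t, ∑ s ∈ Finset.range (t + 1), min 1 (8 * lam ^ (t - s)) * a s =
      min 1 (8 * lam ^ t) * a 0 + ∑ s ∈ Finset.Ico 1 (t + 1), min 1 (8 * lam ^ (t - s)) * a s := by
    intro t
    rw [Finset.range_eq_Ico, Finset.sum_eq_sum_Ico_succ_bot (by omega)]
    rfl
  simp_rw [hsplit]
  rw [Finset.sum_add_distrib]
  refine add_le_add ?_ ?_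
  · rw [← Finset.sum_mul]
    refine mul_le_mul_of_nonneg_right ?_ ha0
    calc ∑ t ∈ Finset.Icc 1 τ, min 1 (8 * lam ^ t)
        ≤ ∑ t ∈ Finset.Icc 1 τ, 8 * lam ^ t := Finset.sum_le_sum fun t _ => min_le_right _ _
      _ = 8 * ∑ t ∈ Finset.Ico 1 (τ + 1), lam ^ t := by rw [← Finset.mul_sum]; rfl
      _ ≤ 8 * (lam / (1 - lam)) := by
          refine mul_le_mul_of_nonneg_left ?_ (by norm_num)
          simpa using geom_sum_Ico_le_of_lt_one (m := 1) (n := τ + 1) h0 h1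
  · rw [Finset.sum_comm' (t' := Finset.Icc 1 τ) (s' := fun s => Finset.Ico s (τ + 1))
      (by intro t s; simp only [Finset.mem_Icc, Finset.mem_Ico]; omega)]
    calc ∑ s ∈ Finset.Icc 1 τ, ∑ t ∈ Finset.Ico s (τ + 1), min 1 (8 * lam ^ (t - s)) * a s
        ≤ ∑ s ∈ Finset.Icc 1 τ, 4 / (1 - lam) * M * (1 / Real.sqrt s) := by
          refine Finset.sum_le_sum fun s hs => ?_
          rw [← Finset.sum_mul, Finset.sum_Ico_eq_sum_range]
          simp only [Nat.add_sub_cancel_left]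
          refine (mul_le_mul_of_nonneg_left (ha s (Finset.mem_Icc.1 hs).1)
            (Finset.sum_nonneg fun n _ => by positivity)).trans ?_
          rw [mul_assoc, mul_one_div]
          exact mul_le_mul_of_nonneg_right (sum_min_one_eight_mul_pow_le h0 h1 _)
            (by positivity)
      _ ≤ 4 / (1 - lam) * M * (2 * Real.sqrt τ) := by
          rw [← Finset.mul_sum]
          exact mul_le_mul_of_nonneg_left (sum_inv_sqrt_le τ) (by positivity)
      _ = _ := by ring

/-! ### Unrolling the perturbed consensus recursion. -/

section Expansion

variable {m : ℕ} {E : Type*} [AddCommGroup E] [Module ℝ E]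

lemma sum_mixMatrix_smul_sum_transition (G : ℕ → Digraph (Fin m)) (e : ℕ → Fin m → E) (t : ℕ)
    (i : Fin m) :
    ∑ j, mixMatrix (G t) i j •
        ∑ s ∈ Finset.range (t + 1), ∑ k, transition G s (t - s) j k • e s k
      = ∑ s ∈ Finset.range (t + 1), ∑ k, transition G s (t - s + 1) i k • e s k := by
  simp_rw [Finset.smul_sum]
  rw [Finset.sum_comm]
  refine Finset.sum_congr rfl fun s hs => ?_
  rw [Finset.sum_comm]
  refine Finset.sum_congr rfl fun k _ => ?_
  have hst : s + (t - s) = t := by have := Finset.mem_range.1 hs; omega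
  rw [transition, Matrix.mul_apply, Finset.sum_smul, hst]
  simp_rw [mul_smul]

lemma eq_sum_transition_smul (G : ℕ → Digraph (Fin m)) {x e : ℕ → Fin m → E} (h0 : x 0 = e 0)
    (hs : ∀ t i, x (t + 1) i = ∑ j, mixMatrix (G t) i j • x t j + e (t + 1) i) (t : ℕ)
    (i : Fin m) :
    x t i = ∑ s ∈ Finset.range (t + 1), ∑ j, transition G s (t - s) i j • e s j := by
  induction t generalizing i with
  | zero => simp [transition, Matrix.one_apply, h0]
  | succ t ih =>
    rw [hs, Finset.sum_range_succ]
    simp_rw [ih]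
    rw [sum_mixMatrix_smul_sum_transition]
    congr 1
    · refine Finset.sum_congr rfl fun s hs => ?_
      rw [Nat.succ_sub (by have := Finset.mem_range.1 hs; omega)]
    · simp [transition, Matrix.one_apply]

lemma sum_eq_sum_perturbations (G : ℕ → Digraph (Fin m)) {x e : ℕ → Fin m → E} (h0 : x 0 = e 0)
    (hs : ∀ t i, x (t + 1) i = ∑ j, mixMatrix (G t) i j • x t j + e (t + 1) i) (t : ℕ) :
    ∑ i, x t i = ∑ s ∈ Finset.range (t + 1), ∑ j, e s j := by
  simp_rw [eq_sum_transition_smul G h0 hs]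
  rw [Finset.sum_comm]
  refine Finset.sum_congr rfl fun s _ => ?_
  rw [Finset.sum_comm]
  simp_rw [← Finset.sum_smul, sum_transition, one_smul]

end Expansion

/-! ### Coefficients of the deviation from the average. -/

lemma weightY_eq {m : ℕ} (G : ℕ → Digraph (Fin m)) (t : ℕ) (i : Fin m) :
    weightY G t i = ∑ j, transition G 0 t i j := by
  induction t generalizing i with
  | zero => simp [weightY, transition, Matrix.one_apply]
  | succ t ih =>
    simp only [weightY, ih, transition, Matrix.mul_apply, zero_add, Finset.mul_sum]
    rw [Finset.sum_comm]

lemma weightY_le {m : ℕ} (G : ℕ → Digraph (Fin m)) (t : ℕ) (i : Fin m) : weightY G t i ≤ m := by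
  rw [weightY_eq]
  refine (Finset.sum_le_sum fun j _ => transition_le_one G 0 t i j).trans ?_
  simp

lemma IsMixingConstants.abs_coeff_le {m : ℕ} {G : ℕ → Digraph (Fin m)} {δ lam : ℝ}
    (h : IsMixingConstants G δ lam) (hm : 0 < m) {s t : ℕ} (hst : s ≤ t) (i j : Fin m) :
    |(weightY G (t + 1) i)⁻¹ * transition G s (t - s + 1) i j - (m : ℝ)⁻¹|
      ≤ min 1 (8 * lam ^ (t - s)) / δ := by
  have hm0 : (0 : ℝ) < m := by exact_mod_cast hm
  set Y := weightY G (t + 1) i with hY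
  have hδY : δ ≤ Y := by rw [hY, weightY_eq]; exact h.delta_le t i
  have hY0 : 0 < Y := h.delta_pos.trans_le hδY
  have hYm : Y ≤ m := weightY_le G _ i
  have hYinv : Y⁻¹ ≤ 1 / δ := by
    rw [← one_div]; exact one_div_le_one_div_of_le h.delta_pos hδY
  have hminv : (m : ℝ)⁻¹ ≤ 1 / δ := by
    rw [← one_div]; exact one_div_le_one_div_of_le h.delta_pos (hδY.trans hYm)
  have hT0 := transition_nonneg G s (t - s + 1) i j
  have hT1 := transition_le_one G s (t - s + 1) i j
  set T := transition G s (t - s + 1) i j with hT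
  rw [← min_div_div_right h.delta_pos.le]
  refine le_min ?_ ?_
  -- Both `T / Y` and `1/m` lie in `[0, 1/δ]`, the latter because `δ ≤ Y ≤ m`.
  · have h1 : Y⁻¹ * T ≤ Y⁻¹ := mul_le_of_le_one_right (by positivity) hT1
    have h2 : 0 ≤ Y⁻¹ * T := by positivity
    have h3 : 0 < (m : ℝ)⁻¹ := by positivity
    rw [abs_sub_le_iff]
    constructor <;> linarith
  · obtain ⟨φ, -, hφ⟩ := h.mixing
    have hA : |T - φ t i| ≤ 4 * lam ^ (t - s) := by
      have := hφ s (t - s) i j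
      rwa [Nat.add_sub_cancel' hst] at this
    have hB : |Y - m * φ t i| ≤ m * (4 * lam ^ (t - s)) := by
      have h1 : Y - m * φ t i = ∑ k, (transition G 0 (t + 1) i k - φ t i) := by
        rw [Finset.sum_sub_distrib, ← weightY_eq]
        simp [hY]
      rw [h1]
      refine (Finset.abs_sum_le_sum_abs _ _).trans ?_
      refine (Finset.sum_le_sum (g := fun _ => 4 * lam ^ (t - s)) fun k _ => ?_).trans (by simp)
      have := hφ 0 t i k
      rw [zero_add] at this
      refine this.trans ?_
      gcongr 4 * ?_
      exact pow_le_pow_of_le_one h.lam_nonneg h.lam_lt_one.le (Nat.sub_le t s)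
    -- The vector `φ` cancels: `T` is close to `φ`, and `Y`, a sum of `m` entries, is close to `m
    -- φ`. Each contributes `4 lam^(t-s)`.
    have he : Y⁻¹ * T - (m : ℝ)⁻¹ = ((T - φ t i) - (m : ℝ)⁻¹ * (Y - m * φ t i)) / Y := by
      field_simp
      ring
    rw [he, abs_div, abs_of_pos hY0]
    refine div_le_div₀ (by have := h.lam_nonneg; positivity) ?_ h.delta_pos hδY
    refine (abs_sub _ _).trans ?_
    rw [abs_mul, abs_of_pos (by positivity : (0 : ℝ) < (m : ℝ)⁻¹)]
    have : (m : ℝ)⁻¹ * |Y - m * φ t i| ≤ (m : ℝ)⁻¹ * (m * (4 * lam ^ (t - s))) := by gcongr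
    rw [inv_mul_cancel_left₀ hm0.ne'] at this
    linarith

lemma IsMixingConstants.norm_sub_average_le {m : ℕ} {E : Type*} [NormedAddCommGroup E]
    [NormedSpace ℝ E] {G : ℕ → Digraph (Fin m)} {δ lam : ℝ}
    (h : IsMixingConstants G δ lam) (hm : 0 < m) {x e : ℕ → Fin m → E} (h0 : x 0 = e 0)
    (hs : ∀ t i, x (t + 1) i = ∑ j, mixMatrix (G t) i j • x t j + e (t + 1) i) (t : ℕ)
    (i : Fin m) :
    ‖(weightY G (t + 1) i)⁻¹ • ∑ j, mixMatrix (G t) i j • x t j - (m : ℝ)⁻¹ • ∑ j, x t j‖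
      ≤ ∑ s ∈ Finset.range (t + 1), min 1 (8 * lam ^ (t - s)) / δ * ∑ j, ‖e s j‖ := by
  rw [sum_eq_sum_perturbations G h0 hs]
  simp_rw [eq_sum_transition_smul G h0 hs]
  rw [sum_mixMatrix_smul_sum_transition]
  simp_rw [Finset.smul_sum, smul_smul]
  rw [← Finset.sum_sub_distrib]
  refine (norm_sum_le _ _).trans (Finset.sum_le_sum fun s hst => ?_)
  rw [← Finset.sum_sub_distrib, Finset.mul_sum]
  refine (norm_sum_le _ _).trans (Finset.sum_le_sum fun j _ => ?_)
  rw [← sub_smul, norm_smul, Real.norm_eq_abs]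
  exact mul_le_mul_of_nonneg_right
    (h.abs_coeff_le hm (Nat.lt_succ_iff.1 (Finset.mem_range.1 hst)) i j) (norm_nonneg _)

/-! ### Gradient steps -/

section Gradient

variable {E : Type*} [NormedAddCommGroup E] [InnerProductSpace ℝ E] [CompleteSpace E]

lemma inner_gradient_sub_nonneg {f : E → ℝ} (hf : Differentiable ℝ f)
    (hc : ConvexOn ℝ Set.univ f) (x y : E) :
    0 ≤ inner ℝ (gradient f x - gradient f y) (x - y) := by
  have hd : ∀ t : ℝ, HasDerivAt (f ∘ AffineMap.lineMap y x)
      (inner ℝ (gradient f (AffineMap.lineMap y x t)) (x - y)) t := by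
    intro t
    have h1 := (hf (AffineMap.lineMap y x t)).hasGradientAt.hasFDerivAt
    simpa using h1.comp_hasDerivAt t AffineMap.hasDerivAt_lineMap
  have hmono := (hc.comp_affineMap (AffineMap.lineMap y x : ℝ →ᵃ[ℝ] E)).monotoneOn_deriv
    fun t _ => (hd t).differentiableAt
  have := hmono (Set.mem_univ (0 : ℝ)) (Set.mem_univ (1 : ℝ)) zero_le_one
  rw [(hd 0).deriv, (hd 1).deriv, AffineMap.lineMap_apply_zero,
    AffineMap.lineMap_apply_one] at this
  rw [inner_sub_left]
  linarith

lemma norm_gradient_le {f : E → ℝ} {L : NNReal} (hlip : LipschitzWith L (gradient f)) (z : E) :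
    ‖gradient f z‖ ≤ ‖gradient f 0‖ + L * ‖z‖ := by
  have := hlip.dist_le_mul z 0
  rw [dist_eq_norm, dist_zero_right] at this
  linarith [norm_sub_norm_le (gradient f z) (gradient f 0)]

/-- Monotonicity of the gradient discards the cross term of the squared norm, so the expansion is
quadratic in `a` with no restriction on the step; the value of the gradient at the origin is split
off. -/
lemma norm_sub_smul_gradient_le {f : E → ℝ} {L : NNReal} (hf : Differentiable ℝ f)
    (hc : ConvexOn ℝ Set.univ f) (hlip : LipschitzWith L (gradient f)) {a : ℝ} (ha : 0 ≤ a)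
    (z : E) :
    ‖z - a • gradient f z‖ ≤ (1 + a ^ 2 * L ^ 2) * ‖z‖ + a * ‖gradient f 0‖ := by
  have h1 : ‖z - a • (gradient f z - gradient f 0)‖ ≤ (1 + a ^ 2 * L ^ 2) * ‖z‖ := by
    refine abs_le_of_sq_le_sq' ?_ (by positivity) |>.2
    have hm := inner_gradient_sub_nonneg hf hc z 0
    have hl := hlip.dist_le_mul z 0
    rw [dist_eq_norm, dist_zero_right] at hl
    rw [sub_zero, real_inner_comm] at hm
    rw [norm_sub_sq_real, inner_smul_right, norm_smul, Real.norm_eq_abs, abs_of_nonneg ha,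
      mul_pow]
    have h2 : ‖gradient f z - gradient f 0‖ ^ 2 ≤ (L * ‖z‖) ^ 2 := by gcongr
    have h3 := mul_le_mul_of_nonneg_left h2 (sq_nonneg a)
    have h4 := mul_nonneg ha hm
    have h5 : 0 ≤ (a ^ 2 * L ^ 2) * ‖z‖ ^ 2 := by positivity
    have h6 : 0 ≤ (a ^ 2 * L ^ 2) ^ 2 * ‖z‖ ^ 2 := by positivity
    nlinarith
  have h2 : z - a • gradient f z
      = (z - a • (gradient f z - gradient f 0)) - a • gradient f 0 := by
    rw [smul_sub]; abel
  rw [h2]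
  refine (norm_sub_le _ _).trans (add_le_add h1 ?_)
  rw [norm_smul, Real.norm_eq_abs, abs_of_nonneg ha]

end Gradient

lemma stepSize_nonneg {α₀ : ℝ} (hα₀ : 0 < α₀) (t : ℕ) : 0 ≤ stepSize α₀ t := by
  unfold stepSize; positivity

lemma stepSize_succ_le {α₀ : ℝ} (hα₀ : 0 < α₀) (t : ℕ) :
    stepSize α₀ (t + 1) ≤ α₀ / ((t + 1 : ℕ) : ℝ) := by
  unfold stepSize
  gcongr
  linarith

lemma sqrt_two_mul_stepSize_succ_le {α₀ : ℝ} (hα₀ : 0 < α₀) (t : ℕ) :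
    Real.sqrt (2 * stepSize α₀ (t + 1)) ≤ Real.sqrt (2 * α₀) / Real.sqrt ((t + 1 : ℕ) : ℝ) := by
  rw [← Real.sqrt_div (by positivity), mul_div_assoc]
  exact Real.sqrt_le_sqrt (mul_le_mul_of_nonneg_left (stepSize_succ_le hα₀ t) (by norm_num))

lemma one_div_le_one_div_sqrt (t : ℕ) :
    1 / ((t + 1 : ℕ) : ℝ) ≤ 1 / Real.sqrt ((t + 1 : ℕ) : ℝ) := by
  refine one_div_le_one_div_of_le (Real.sqrt_pos.2 (by positivity)) ?_
  have : (1 : ℝ) ≤ ((t + 1 : ℕ) : ℝ) := by exact_mod_cast Nat.succ_pos t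
  exact Real.sqrt_le_iff.2 ⟨by positivity, by nlinarith⟩

/-! ### Integrability and first moments of the iterates -/

section Moments

variable {m d : ℕ} {Ω : Type*} [MeasurableSpace Ω] {P : Measure Ω} [IsProbabilityMeasure P]
  {G : ℕ → Digraph (Fin m)} {U : Fin m → EuclideanSpace ℝ (Fin d) → ℝ} {L : NNReal}
  {α₀ : ℝ} {x₀ : Fin m → EuclideanSpace ℝ (Fin d)}
  {b : Ω → ℕ → Fin m → EuclideanSpace ℝ (Fin d)}

lemma integrable_perturb {f : EuclideanSpace ℝ (Fin d) → ℝ} (hlip : LipschitzWith L (gradient f))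
    (α₀ : ℝ) (t : ℕ) {z w : Ω → EuclideanSpace ℝ (Fin d)} (hz : Integrable z P)
    (hw : Integrable w P) : Integrable (fun ω => perturb α₀ f t (z ω) (w ω)) P := by
  have hm : AEStronglyMeasurable (fun ω => gradient f (z ω)) P :=
    hlip.continuous.comp_aestronglyMeasurable hz.aestronglyMeasurable
  have hd : Integrable (fun ω => ‖gradient f 0‖ + (L : ℝ) * ‖z ω‖) P :=
    (integrable_const _).add (hz.norm.const_mul _)
  have hg : Integrable (fun ω => gradient f (z ω)) P :=
    hd.mono' hm (Filter.Eventually.of_forall fun ω => norm_gradient_le hlip (z ω))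
  have h1 : Integrable (fun ω => -(stepSize α₀ t • gradient f (z ω))) P :=
    (hg.smul (stepSize α₀ t)).neg
  have h2 : Integrable (fun ω => Real.sqrt (2 * stepSize α₀ t) • w ω) P :=
    hw.smul (Real.sqrt (2 * stepSize α₀ t))
  exact h1.add h2

omit [IsProbabilityMeasure P] in
lemma integrable_balanced (G : ℕ → Digraph (Fin m)) (t : ℕ)
    {X : Ω → Fin m → EuclideanSpace ℝ (Fin d)} (hX : ∀ i, Integrable (fun ω => X ω i) P)
    (i : Fin m) : Integrable (fun ω => balanced G t (X ω) i) P :=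
  (integrable_finsetSum _ fun j _ => (hX j).smul (mixMatrix (G t) i j)).smul
    (weightY G (t + 1) i)⁻¹

lemma integrable_iterX (hlip : ∀ i, LipschitzWith L (gradient (U i)))
    (hb : ∀ t i, Integrable (fun ω => b ω (t + 1) i) P) (t : ℕ) (i : Fin m) :
    Integrable (fun ω => iterX G U α₀ x₀ (b ω) t i) P := by
  induction t generalizing i with
  | zero => exact integrable_const _
  | succ t ih =>
    exact (integrable_finsetSum _ fun j _ => (ih j).smul (mixMatrix (G t) i j)).add
      (integrable_perturb (hlip i) α₀ (t + 1) (integrable_balanced G t ih i) (hb t i))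

lemma integrable_iterZ_succ (hlip : ∀ i, LipschitzWith L (gradient (U i)))
    (hb : ∀ t i, Integrable (fun ω => b ω (t + 1) i) P) (t : ℕ) (i : Fin m) :
    Integrable (fun ω => iterZ G U α₀ x₀ (b ω) (t + 1) i) P :=
  integrable_balanced G t (integrable_iterX hlip hb t) i

lemma integrable_iterE_succ (hlip : ∀ i, LipschitzWith L (gradient (U i)))
    (hb : ∀ t i, Integrable (fun ω => b ω (t + 1) i) P) (t : ℕ) (i : Fin m) :
    Integrable (fun ω => iterE G U α₀ x₀ (b ω) (t + 1) i) P :=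
  integrable_perturb (hlip i) α₀ (t + 1) (integrable_iterZ_succ hlip hb t i) (hb t i)

lemma integrable_avgX (hlip : ∀ i, LipschitzWith L (gradient (U i)))
    (hb : ∀ t i, Integrable (fun ω => b ω (t + 1) i) P) (t : ℕ) :
    Integrable (fun ω => avgX G U α₀ x₀ (b ω) t) P := by
  have h : Integrable (fun ω => ∑ j, iterX G U α₀ x₀ (b ω) t j) P :=
    integrable_finsetSum _ fun j _ => integrable_iterX hlip hb t j
  exact h.smul (m : ℝ)⁻¹

-- The profile `weightY G t * v` is carried by the averaging exactly to `weightY G (t + 1) * v`, so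
-- the normalisation loses nothing.
omit [IsProbabilityMeasure P] in
lemma integral_norm_balanced_le {t : ℕ} {v : ℝ} (hY : ∀ i, 0 < weightY G (t + 1) i)
    {X : Ω → Fin m → EuclideanSpace ℝ (Fin d)} (hX : ∀ i, Integrable (fun ω => X ω i) P)
    (hv : ∀ i, ∫ ω, ‖X ω i‖ ∂P ≤ weightY G t i * v) (i : Fin m) :
    ∫ ω, ‖balanced G t (X ω) i‖ ∂P ≤ v := by
  have hpt : ∀ ω, ‖balanced G t (X ω) i‖
      ≤ (weightY G (t + 1) i)⁻¹ * ∑ j, mixMatrix (G t) i j * ‖X ω j‖ := by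
    intro ω
    rw [balanced, norm_smul, Real.norm_eq_abs, abs_of_pos (inv_pos.2 (hY i))]
    refine mul_le_mul_of_nonneg_left ((norm_sum_le _ _).trans_eq ?_) (inv_pos.2 (hY i)).le
    refine Finset.sum_congr rfl fun j _ => ?_
    rw [norm_smul, Real.norm_eq_abs, abs_of_nonneg (mixMatrix_nonneg _ _ _)]
  have hint : ∀ j, Integrable (fun ω => mixMatrix (G t) i j * ‖X ω j‖) P :=
    fun j => (hX j).norm.const_mul _
  calc ∫ ω, ‖balanced G t (X ω) i‖ ∂P
      ≤ ∫ ω, (weightY G (t + 1) i)⁻¹ * ∑ j, mixMatrix (G t) i j * ‖X ω j‖ ∂P :=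
        integral_mono (integrable_balanced G t hX i).norm
          ((integrable_finsetSum _ fun j _ => hint j).const_mul _) hpt
    _ = (weightY G (t + 1) i)⁻¹ * ∑ j, mixMatrix (G t) i j * ∫ ω, ‖X ω j‖ ∂P := by
        rw [integral_const_mul, integral_finsetSum _ fun j _ => hint j]
        simp_rw [integral_const_mul]
    _ ≤ (weightY G (t + 1) i)⁻¹ * ∑ j, mixMatrix (G t) i j * (weightY G t j * v) := by
        refine mul_le_mul_of_nonneg_left (Finset.sum_le_sum fun j _ => ?_) (inv_pos.2 (hY i)).le
        exact mul_le_mul_of_nonneg_left (hv j) (mixMatrix_nonneg _ _ _)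
    _ = (weightY G (t + 1) i)⁻¹ * (weightY G (t + 1) i * v) := by
        simp only [weightY, ← mul_assoc, ← Finset.sum_mul]
    _ = v := inv_mul_cancel_left₀ (hY i).ne' v

lemma integral_norm_add_perturb_le {f : EuclideanSpace ℝ (Fin d) → ℝ}
    (hf : Differentiable ℝ f) (hc : ConvexOn ℝ Set.univ f) (hlip : LipschitzWith L (gradient f))
    (hα₀ : 0 < α₀) (t : ℕ) {η y v β : ℝ} (hη : 0 < η) (hηy : η ≤ y)
    {z w : Ω → EuclideanSpace ℝ (Fin d)} (hz : Integrable z P) (hw : Integrable w P)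
    (hv : ∫ ω, ‖z ω‖ ∂P ≤ v) (hβ : ∫ ω, ‖w ω‖ ∂P ≤ β) :
    ∫ ω, ‖y • z ω + perturb α₀ f (t + 1) (z ω) (w ω)‖ ∂P
      ≤ y * ((1 + (α₀ * L / η) ^ 2 * (1 / ((t + 1 : ℕ) : ℝ) ^ 2)) * v
        + (α₀ * ‖gradient f 0‖ + Real.sqrt (2 * α₀) * β) / η
            * (1 / Real.sqrt ((t + 1 : ℕ) : ℝ))) := by
  have hy : 0 < y := hη.trans_le hηy
  have hβ0 : 0 ≤ β := (integral_nonneg fun _ => norm_nonneg _).trans hβ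
  have hv0 : 0 ≤ v := (integral_nonneg fun _ => norm_nonneg _).trans hv
  have hα := stepSize_nonneg hα₀ (t + 1)
  have hαle := stepSize_succ_le hα₀ t
  set α := stepSize α₀ (t + 1) with hαdef
  have hT : (0 : ℝ) < ((t + 1 : ℕ) : ℝ) := by positivity
  set T : ℝ := ((t + 1 : ℕ) : ℝ) with hTdef
  have hay : α / y ≤ α₀ / η * (1 / T) := by
    rw [div_mul_div_comm, mul_one, mul_comm, ← div_div]
    exact div_le_div₀ (by positivity) hαle hη hηy
  have hpt : ∀ ω, ‖y • z ω + perturb α₀ f (t + 1) (z ω) (w ω)‖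
      ≤ y * ((1 + (α / y) ^ 2 * L ^ 2) * ‖z ω‖ + α / y * ‖gradient f 0‖)
        + Real.sqrt (2 * α) * ‖w ω‖ := by
    intro ω
    -- Factoring out the weight exhibits a gradient step of effective length `α / y`.
    have h1 : y • z ω + perturb α₀ f (t + 1) (z ω) (w ω)
        = y • (z ω - (α / y) • gradient f (z ω)) + Real.sqrt (2 * α) • w ω := by
      rw [perturb, smul_sub, smul_smul, mul_div_cancel₀ _ hy.ne']
      abel
    rw [h1]
    refine (norm_add_le _ _).trans (add_le_add ?_ ?_)
    · rw [norm_smul, Real.norm_eq_abs, abs_of_pos hy]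
      exact mul_le_mul_of_nonneg_left
        (norm_sub_smul_gradient_le hf hc hlip (by positivity) _) hy.le
    · rw [norm_smul, Real.norm_eq_abs, abs_of_nonneg (Real.sqrt_nonneg _)]
  have hi1 : Integrable (fun ω => (1 + (α / y) ^ 2 * L ^ 2) * ‖z ω‖) P := hz.norm.const_mul _
  have hi2 : Integrable (fun ω => (1 + (α / y) ^ 2 * L ^ 2) * ‖z ω‖ + α / y * ‖gradient f 0‖) P :=
    hi1.add (integrable_const _)
  have hi3 : Integrable (fun ω => Real.sqrt (2 * α) * ‖w ω‖) P := hw.norm.const_mul _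
  have hsq := sqrt_two_mul_stepSize_succ_le hα₀ t
  have hone := one_div_le_one_div_sqrt t
  rw [← hTdef] at hone
  calc ∫ ω, ‖y • z ω + perturb α₀ f (t + 1) (z ω) (w ω)‖ ∂P
      ≤ ∫ ω, (y * ((1 + (α / y) ^ 2 * L ^ 2) * ‖z ω‖ + α / y * ‖gradient f 0‖)
        + Real.sqrt (2 * α) * ‖w ω‖) ∂P :=
        integral_mono ((hz.smul y).add (integrable_perturb hlip α₀ (t + 1) hz hw)).norm
          ((hi2.const_mul y).add hi3) hpt
    _ = y * ((1 + (α / y) ^ 2 * L ^ 2) * ∫ ω, ‖z ω‖ ∂P)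
        + (α * ‖gradient f 0‖ + Real.sqrt (2 * α) * ∫ ω, ‖w ω‖ ∂P) := by
        rw [integral_add (hi2.const_mul y) hi3, integral_const_mul, integral_const_mul,
          integral_add hi1 (integrable_const _), integral_const_mul]
        simp only [integral_const, probReal_univ, one_smul]
        field_simp
        ring
    _ ≤ y * ((1 + (α₀ * L / η) ^ 2 * (1 / T ^ 2)) * v)
        + y * ((α₀ * ‖gradient f 0‖ + Real.sqrt (2 * α₀) * β) / η * (1 / Real.sqrt T)) := by
        refine add_le_add ?_ ?_
        · have h1 : (α / y) ^ 2 * L ^ 2 ≤ (α₀ * L / η) ^ 2 * (1 / T ^ 2) := by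
            calc (α / y) ^ 2 * (L : ℝ) ^ 2 ≤ (α₀ / η * (1 / T)) ^ 2 * (L : ℝ) ^ 2 := by gcongr
              _ = _ := by ring
          gcongr
        · have h2 : α * ‖gradient f 0‖ + Real.sqrt (2 * α) * ∫ ω, ‖w ω‖ ∂P
              ≤ (α₀ * ‖gradient f 0‖ + Real.sqrt (2 * α₀) * β) * (1 / Real.sqrt T) := by
            rw [add_mul]
            refine add_le_add ?_ ?_
            · calc α * ‖gradient f 0‖ ≤ α₀ / T * ‖gradient f 0‖ := by gcongr
                _ = α₀ * ‖gradient f 0‖ * (1 / T) := by ring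
                _ ≤ _ := by gcongr
            · calc Real.sqrt (2 * α) * ∫ ω, ‖w ω‖ ∂P
                  ≤ Real.sqrt (2 * α₀) / Real.sqrt T * β := by gcongr
                _ = _ := by ring
          refine h2.trans ?_
          -- The noise contribution has no factor `y`; dividing by `η` supplies one, restoring the
          -- form `y * v`.
          have h3 : 1 ≤ y / η := by rwa [one_le_div hη]
          calc (α₀ * ‖gradient f 0‖ + Real.sqrt (2 * α₀) * β) * (1 / Real.sqrt T)
              ≤ (y / η) * ((α₀ * ‖gradient f 0‖ + Real.sqrt (2 * α₀) * β) * (1 / Real.sqrt T)) :=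
                le_mul_of_one_le_left (by positivity) h3
            _ = _ := by ring
    _ = _ := by ring

/-- First moment bound `v(t) = exp(c ∑_{s<t} 1/(s+1)²) (V + 2 C √t)`, with `V` the initial size,
`C` the size of the noise and `c` the expansion of the gradient steps. -/
noncomputable def momentBound (c V C : ℝ) (t : ℕ) : ℝ :=
  Real.exp (c * ∑ s ∈ Finset.range t, 1 / ((s + 1 : ℕ) : ℝ) ^ 2) * (V + 2 * C * Real.sqrt t)

/-- The expansion is absorbed by `1 + x ≤ exp x` and the noise by `1/√(t+1) ≤ 2(√(t+1) - √t)`, the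
exponential factors being at least `1`. -/
lemma momentBound_succ_ge {c V C : ℝ} (hc : 0 ≤ c) (hV : 0 ≤ V) (hC : 0 ≤ C) (t : ℕ) :
    (1 + c * (1 / ((t + 1 : ℕ) : ℝ) ^ 2)) * momentBound c V C t
      + C * (1 / Real.sqrt ((t + 1 : ℕ) : ℝ)) ≤ momentBound c V C (t + 1) := by
  simp only [momentBound]
  rw [Finset.sum_range_succ, mul_add c, Real.exp_add]
  set S := ∑ s ∈ Finset.range t, 1 / ((s + 1 : ℕ) : ℝ) ^ 2 with hS
  have hS0 : 0 ≤ S := Finset.sum_nonneg fun s _ => by positivity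
  have h1 : 1 + c * (1 / ((t + 1 : ℕ) : ℝ) ^ 2) ≤ Real.exp (c * (1 / ((t + 1 : ℕ) : ℝ) ^ 2)) := by
    linarith [Real.add_one_le_exp (c * (1 / ((t + 1 : ℕ) : ℝ) ^ 2))]
  have h2 : 1 ≤ Real.exp (c * S) := Real.one_le_exp (by positivity)
  have h3 : 1 ≤ Real.exp (c * (1 / ((t + 1 : ℕ) : ℝ) ^ 2)) := Real.one_le_exp (by positivity)
  set E₁ := Real.exp (c * S)
  set E₂ := Real.exp (c * (1 / ((t + 1 : ℕ) : ℝ) ^ 2))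
  have h4 := two_mul_sqrt_add_inv_sqrt_le t
  have h5 : 1 ≤ E₁ * E₂ := one_le_mul_of_one_le_of_one_le h2 h3
  have h6 : 0 ≤ C * (1 / Real.sqrt ((t + 1 : ℕ) : ℝ)) := by positivity
  calc (1 + c * (1 / ((t + 1 : ℕ) : ℝ) ^ 2)) * (E₁ * (V + 2 * C * Real.sqrt t))
        + C * (1 / Real.sqrt ((t + 1 : ℕ) : ℝ))
      ≤ E₂ * (E₁ * (V + 2 * C * Real.sqrt t))
        + (E₁ * E₂) * (C * (1 / Real.sqrt ((t + 1 : ℕ) : ℝ))) := by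
        refine add_le_add ?_ (le_mul_of_one_le_left h6 h5)
        gcongr
    _ = E₁ * E₂ * (V + C * (2 * Real.sqrt t + 1 / Real.sqrt ((t + 1 : ℕ) : ℝ))) := by ring
    _ ≤ E₁ * E₂ * (V + C * (2 * Real.sqrt ((t + 1 : ℕ) : ℝ))) := by gcongr
    _ = _ := by ring

lemma momentBound_le {c V C : ℝ} (hc : 0 ≤ c) (hV : 0 ≤ V) (hC : 0 ≤ C) (t : ℕ) :
    momentBound c V C t ≤ Real.exp (c * ∑' s : ℕ, 1 / ((s + 1 : ℕ) : ℝ) ^ 2)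
      * (V + 2 * C) * Real.sqrt ((t + 1 : ℕ) : ℝ) := by
  have hsum : Summable fun s : ℕ => 1 / ((s + 1 : ℕ) : ℝ) ^ 2 :=
    (summable_nat_add_iff (f := fun s : ℕ => 1 / (s : ℝ) ^ 2) 1).2
      (Real.summable_one_div_nat_pow.2 (by norm_num))
  have h1 : ∑ s ∈ Finset.range t, 1 / ((s + 1 : ℕ) : ℝ) ^ 2
      ≤ ∑' s : ℕ, 1 / ((s + 1 : ℕ) : ℝ) ^ 2 :=
    hsum.sum_le_tsum _ fun s _ => by positivity
  have h2 : 1 ≤ Real.sqrt ((t + 1 : ℕ) : ℝ) := by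
    rw [Real.one_le_sqrt]; exact_mod_cast Nat.succ_pos t
  have h3 : Real.sqrt t ≤ Real.sqrt ((t + 1 : ℕ) : ℝ) :=
    Real.sqrt_le_sqrt (by exact_mod_cast Nat.le_succ t)
  unfold momentBound
  rw [mul_assoc (Real.exp _)]
  refine mul_le_mul (Real.exp_le_exp.2 (mul_le_mul_of_nonneg_left h1 hc)) ?_ (by positivity)
    (Real.exp_nonneg _)
  nlinarith [mul_le_mul_of_nonneg_left h3 hC]

lemma integral_norm_iterX_le (hdiff : ∀ i, Differentiable ℝ (U i))
    (hconv : ∀ i, ConvexOn ℝ Set.univ (U i)) (hlip : ∀ i, LipschitzWith L (gradient (U i)))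
    (hα₀ : 0 < α₀) {η β : ℝ} (hη : 0 < η) (hY : ∀ t i, η ≤ weightY G t i)
    (hb : ∀ t i, Integrable (fun ω => b ω (t + 1) i) P)
    (hβ : ∀ t i, ∫ ω, ‖b ω (t + 1) i‖ ∂P ≤ β) (t : ℕ) (i : Fin m) :
    ∫ ω, ‖iterX G U α₀ x₀ (b ω) t i‖ ∂P ≤ weightY G t i *
      momentBound ((α₀ * L / η) ^ 2) (∑ j, ‖x₀ j‖)
        ((α₀ * ∑ j, ‖gradient (U j) 0‖ + Real.sqrt (2 * α₀) * β) / η) t := by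
  have hβ0 : 0 ≤ β := (integral_nonneg fun _ => norm_nonneg _).trans (hβ 0 i)
  have hV : 0 ≤ ∑ j, ‖x₀ j‖ := Finset.sum_nonneg fun j _ => norm_nonneg _
  have hg : ∀ i, ‖gradient (U i) 0‖ ≤ ∑ j, ‖gradient (U j) 0‖ := fun i =>
    Finset.single_le_sum (f := fun j => ‖gradient (U j) 0‖) (fun j _ => norm_nonneg _)
      (Finset.mem_univ i)
  have hg0 : 0 ≤ ∑ j, ‖gradient (U j) 0‖ := (norm_nonneg _).trans (hg i)
  induction t generalizing i with
  | zero =>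
    simpa [iterX, weightY, momentBound] using
      Finset.single_le_sum (f := fun j => ‖x₀ j‖) (fun j _ => norm_nonneg _) (Finset.mem_univ i)
  | succ t ih =>
    have hX := integrable_iterX (P := P) (G := G) (α₀ := α₀) (x₀ := x₀) hlip hb t
    have hY0 : ∀ i, 0 < weightY G (t + 1) i := fun i => hη.trans_le (hY (t + 1) i)
    have hz := integral_norm_balanced_le hY0 hX ih i
    have hstep := integral_norm_add_perturb_le (hdiff i) (hconv i) (hlip i) hα₀ t hη
      (hY (t + 1) i) (integrable_balanced G t hX i) (hb t i) hz (hβ t i)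
    have he : ∀ ω, iterX G U α₀ x₀ (b ω) (t + 1) i
        = weightY G (t + 1) i • balanced G t (iterX G U α₀ x₀ (b ω) t) i
          + perturb α₀ (U i) (t + 1) (balanced G t (iterX G U α₀ x₀ (b ω) t) i)
            (b ω (t + 1) i) := by
      intro ω
      simp only [iterX, balanced, smul_inv_smul₀ (hY0 i).ne']
    simp_rw [he]
    refine hstep.trans (mul_le_mul_of_nonneg_left ?_ (hY0 i).le)
    refine le_trans ?_ (momentBound_succ_ge (sq_nonneg _) hV (by positivity) t)
    gcongr
    exact hg i

/-- A bound on `√t E‖e_i(t)‖`, for gradients of total size `g` at the origin, initial size `V`,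
weights at least `η` and noise of mean size at most `β`. -/
noncomputable def perturbBound (L : NNReal) (α₀ η β V g : ℝ) : ℝ :=
  α₀ * (g + L * (Real.exp ((α₀ * L / η) ^ 2 * ∑' s : ℕ, 1 / ((s + 1 : ℕ) : ℝ) ^ 2)
      * (V + 2 * ((α₀ * g + Real.sqrt (2 * α₀) * β) / η))))
    + Real.sqrt (2 * α₀) * β

lemma integral_norm_iterE_succ_le (hdiff : ∀ i, Differentiable ℝ (U i))
    (hconv : ∀ i, ConvexOn ℝ Set.univ (U i)) (hlip : ∀ i, LipschitzWith L (gradient (U i)))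
    (hα₀ : 0 < α₀) {η β : ℝ} (hη : 0 < η) (hY : ∀ t i, η ≤ weightY G t i)
    (hb : ∀ t i, Integrable (fun ω => b ω (t + 1) i) P)
    (hβ : ∀ t i, ∫ ω, ‖b ω (t + 1) i‖ ∂P ≤ β) (t : ℕ) (i : Fin m) :
    ∫ ω, ‖iterE G U α₀ x₀ (b ω) (t + 1) i‖ ∂P ≤
      perturbBound L α₀ η β (∑ j, ‖x₀ j‖) (∑ j, ‖gradient (U j) 0‖)
        / Real.sqrt ((t + 1 : ℕ) : ℝ) := by
  unfold perturbBound
  have hβ0 : 0 ≤ β := (integral_nonneg fun _ => norm_nonneg _).trans (hβ 0 i)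
  have hV : 0 ≤ ∑ j, ‖x₀ j‖ := Finset.sum_nonneg fun j _ => norm_nonneg _
  have hg : ‖gradient (U i) 0‖ ≤ ∑ j, ‖gradient (U j) 0‖ :=
    Finset.single_le_sum (f := fun j => ‖gradient (U j) 0‖) (fun j _ => norm_nonneg _)
      (Finset.mem_univ i)
  have hg0 : 0 ≤ ∑ j, ‖gradient (U j) 0‖ := (norm_nonneg _).trans hg
  have hX := integrable_iterX (P := P) (G := G) (α₀ := α₀) (x₀ := x₀) hlip hb t
  have hYX := integral_norm_iterX_le (P := P) (G := G) (x₀ := x₀) hdiff hconv hlip hα₀ hη hY hb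
    hβ t
  set g := ∑ j, ‖gradient (U j) 0‖
  set C := (α₀ * g + Real.sqrt (2 * α₀) * β) / η with hCdef
  have hC : 0 ≤ C := by positivity
  have hz := (integral_norm_balanced_le (fun i => hη.trans_le (hY (t + 1) i)) hX hYX i).trans
    (momentBound_le (sq_nonneg _) hV hC t)
  have hzi := integrable_balanced G t hX i
  set M := Real.exp ((α₀ * L / η) ^ 2 * ∑' s : ℕ, 1 / ((s + 1 : ℕ) : ℝ) ^ 2)
    * (∑ j, ‖x₀ j‖ + 2 * C)
  have hM : 0 ≤ M := by positivity
  set z : Ω → EuclideanSpace ℝ (Fin d) := fun ω => balanced G t (iterX G U α₀ x₀ (b ω) t) i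
  have hα := stepSize_nonneg hα₀ (t + 1)
  have hαle := stepSize_succ_le hα₀ t
  have hsq := sqrt_two_mul_stepSize_succ_le hα₀ t
  have hone := one_div_le_one_div_sqrt t
  have hpt : ∀ ω, ‖iterE G U α₀ x₀ (b ω) (t + 1) i‖
      ≤ stepSize α₀ (t + 1) * (g + L * ‖z ω‖)
        + Real.sqrt (2 * stepSize α₀ (t + 1)) * ‖b ω (t + 1) i‖ := by
    intro ω
    refine (norm_add_le _ _).trans (add_le_add ?_ ?_)
    · rw [norm_neg, norm_smul, Real.norm_eq_abs, abs_of_nonneg hα]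
      exact mul_le_mul_of_nonneg_left
        ((norm_gradient_le (hlip i) (z ω)).trans (by gcongr)) hα
    · rw [norm_smul, Real.norm_eq_abs, abs_of_nonneg (Real.sqrt_nonneg _)]
  have hi1 : Integrable (fun ω => L * ‖z ω‖) P := hzi.norm.const_mul _
  have hi2 : Integrable (fun ω => g + L * ‖z ω‖) P := (integrable_const _).add hi1
  have hi3 : Integrable (fun ω => Real.sqrt (2 * stepSize α₀ (t + 1)) * ‖b ω (t + 1) i‖) P :=
    (hb t i).norm.const_mul _
  have hT1 : (1 : ℝ) ≤ Real.sqrt ((t + 1 : ℕ) : ℝ) := by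
    rw [Real.one_le_sqrt]; exact_mod_cast Nat.succ_pos t
  have hTs : Real.sqrt ((t + 1 : ℕ) : ℝ) * Real.sqrt ((t + 1 : ℕ) : ℝ) = ((t + 1 : ℕ) : ℝ) :=
    Real.mul_self_sqrt (by positivity)
  calc ∫ ω, ‖iterE G U α₀ x₀ (b ω) (t + 1) i‖ ∂P
      ≤ ∫ ω, (stepSize α₀ (t + 1) * (g + L * ‖z ω‖)
        + Real.sqrt (2 * stepSize α₀ (t + 1)) * ‖b ω (t + 1) i‖) ∂P :=
        integral_mono (integrable_iterE_succ hlip hb t i).norm ((hi2.const_mul _).add hi3) hpt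
    _ = stepSize α₀ (t + 1) * (g + L * ∫ ω, ‖z ω‖ ∂P)
        + Real.sqrt (2 * stepSize α₀ (t + 1)) * ∫ ω, ‖b ω (t + 1) i‖ ∂P := by
        rw [integral_add (hi2.const_mul _) hi3, integral_const_mul, integral_const_mul,
          integral_add (integrable_const _) hi1, integral_const_mul]
        simp only [integral_const, probReal_univ, one_smul]
    _ ≤ α₀ / ((t + 1 : ℕ) : ℝ) * (Real.sqrt ((t + 1 : ℕ) : ℝ) * (g + L * M))
        + Real.sqrt (2 * α₀) / Real.sqrt ((t + 1 : ℕ) : ℝ) * β := by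
        have h1 : g + L * ∫ ω, ‖z ω‖ ∂P ≤ Real.sqrt ((t + 1 : ℕ) : ℝ) * (g + L * M) := by
          rw [mul_add]
          refine add_le_add (le_mul_of_one_le_left hg0 hT1) ?_
          calc L * ∫ ω, ‖z ω‖ ∂P ≤ L * (M * Real.sqrt ((t + 1 : ℕ) : ℝ)) := by gcongr
            _ = _ := by ring
        refine add_le_add ?_ ?_
        · exact mul_le_mul hαle h1 (add_nonneg hg0 (mul_nonneg L.2
            (integral_nonneg fun _ => norm_nonneg _))) (by positivity)
        · exact mul_le_mul hsq (hβ t i) (integral_nonneg fun _ => norm_nonneg _) (by positivity)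
    _ = _ := by
        have hr : Real.sqrt ((t + 1 : ℕ) : ℝ) ≠ 0 := by positivity
        -- Writing `t + 1` as a product of square roots leaves one factor `1/√(t+1)` in the gradient
        -- term.
        rw [show α₀ / ((t + 1 : ℕ) : ℝ) = α₀ / _ by rw [← hTs]]
        generalize Real.sqrt ((t + 1 : ℕ) : ℝ) = r at hr
        field_simp

end Moments

/-! ### The noise and the accumulated consensus error -/

lemma norm_le_sum_abs {d : ℕ} (x : EuclideanSpace ℝ (Fin d)) : ‖x‖ ≤ ∑ k, |x k| := by
  conv_lhs => rw [← (EuclideanSpace.basisFun (Fin d) ℝ).sum_repr x]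
  refine (norm_sum_le _ _).trans_eq (Finset.sum_congr rfl fun k _ => ?_)
  rw [norm_smul, (EuclideanSpace.basisFun (Fin d) ℝ).orthonormal.1 k, mul_one, Real.norm_eq_abs,
    EuclideanSpace.basisFun_repr]

section Noise

variable {m d : ℕ} {Ω : Type*} [MeasurableSpace Ω] {P : Measure Ω} [IsProbabilityMeasure P]
  {ℱ : Filtration ℕ ‹MeasurableSpace Ω›} {α₀ σ ρ : ℝ}
  {ξ R : ℕ → Fin m → Ω → EuclideanSpace ℝ (Fin d)}

omit [IsProbabilityMeasure P] in
lemma IsNoise.integrable_gauss (h : IsNoise P ℱ σ ρ ξ R) (t : ℕ) (i : Fin m) :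
    Integrable (R (t + 1) i) P := by
  have hR : Measurable (R (t + 1) i) := (h.measurable_gauss t i).mono (ℱ.le _) le_rfl
  have hs : Measurable fun x : EuclideanSpace ℝ (Fin d) => ρ • x := measurable_const_smul ρ
  have hid : Integrable (fun x : EuclideanSpace ℝ (Fin d) => x) (P.map (R (t + 1) i)) := by
    rw [h.law_gauss]
    refine (integrable_map_measure aestronglyMeasurable_id hs.aemeasurable).2 ?_
    exact (IsGaussian.integrable_id (μ := stdGaussian (EuclideanSpace ℝ (Fin d)))).smul ρ
  exact (integrable_map_measure aestronglyMeasurable_id hR.aemeasurable).1 hid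

-- The moment depends on the law alone, so the resulting constant does not see the probability
-- space.
omit [IsProbabilityMeasure P] in
lemma IsNoise.integral_norm_gauss (h : IsNoise P ℱ σ ρ ξ R) (t : ℕ) (i : Fin m) :
    ∫ ω, ‖R (t + 1) i ω‖ ∂P
      = ∫ x, ‖x‖ ∂((stdGaussian (EuclideanSpace ℝ (Fin d))).map (fun x => ρ • x)) := by
  have hR : Measurable (R (t + 1) i) := (h.measurable_gauss t i).mono (ℱ.le _) le_rfl
  rw [← h.law_gauss t i, integral_map hR.aemeasurable (by fun_prop)]

lemma IsNoise.integral_norm_error_le (h : IsNoise P ℱ σ ρ ξ R) (t : ℕ) (i : Fin m) :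
    ∫ ω, ‖ξ (t + 1) i ω‖ ∂P ≤ 1 + σ ^ 2 := by
  have h2 : Integrable (fun ω => ‖ξ (t + 1) i ω‖ ^ 2) P :=
    (h.memLp_error t i).integrable_norm_pow (by norm_num)
  have h1 : Integrable (ξ (t + 1) i) P := (h.memLp_error t i).integrable one_le_two
  calc ∫ ω, ‖ξ (t + 1) i ω‖ ∂P ≤ ∫ ω, (1 + ‖ξ (t + 1) i ω‖ ^ 2) ∂P :=
        integral_mono h1.norm ((integrable_const _).add h2) fun ω => by
          change ‖ξ (t + 1) i ω‖ ≤ 1 + ‖ξ (t + 1) i ω‖ ^ 2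
          nlinarith [sq_nonneg (‖ξ (t + 1) i ω‖ - 1)]
    _ = 1 + ∫ ω, ‖ξ (t + 1) i ω‖ ^ 2 ∂P := by
        rw [integral_add (integrable_const _) h2]; simp
    _ ≤ 1 + σ ^ 2 := by linarith [h.variance_le t i]

lemma IsNoise.integrable_noise (h : IsNoise P ℱ σ ρ ξ R) (t : ℕ) (i : Fin m) :
    Integrable (fun ω => noise α₀ ξ R ω (t + 1) i) P := by
  have h1 : Integrable (fun ω => Real.sqrt (stepSize α₀ (t + 1)) • ξ (t + 1) i ω) P :=
    ((h.memLp_error t i).integrable one_le_two).smul (Real.sqrt (stepSize α₀ (t + 1)))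
  exact h1.add (h.integrable_gauss t i)

lemma IsNoise.integral_norm_noise_le (h : IsNoise P ℱ σ ρ ξ R) (hα₀ : 0 < α₀) (t : ℕ)
    (i : Fin m) :
    ∫ ω, ‖noise α₀ ξ R ω (t + 1) i‖ ∂P ≤ Real.sqrt α₀ * (1 + σ ^ 2)
      + ∫ x, ‖x‖ ∂((stdGaussian (EuclideanSpace ℝ (Fin d))).map (fun x => ρ • x)) := by
  have h1 : Integrable (fun ω => Real.sqrt (stepSize α₀ (t + 1)) * ‖ξ (t + 1) i ω‖) P :=
    ((h.memLp_error t i).integrable one_le_two).norm.const_mul _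
  have h2 := (h.integrable_gauss t i).norm
  have hs : Real.sqrt (stepSize α₀ (t + 1)) ≤ Real.sqrt α₀ := by
    refine Real.sqrt_le_sqrt ((stepSize_succ_le hα₀ t).trans (div_le_self hα₀.le ?_))
    exact_mod_cast Nat.succ_pos t
  calc ∫ ω, ‖noise α₀ ξ R ω (t + 1) i‖ ∂P
      ≤ ∫ ω, (Real.sqrt (stepSize α₀ (t + 1)) * ‖ξ (t + 1) i ω‖ + ‖R (t + 1) i ω‖) ∂P := by
        refine integral_mono (h.integrable_noise t i).norm (h1.add h2) fun ω => ?_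
        refine (norm_add_le _ _).trans_eq ?_
        rw [norm_smul, Real.norm_eq_abs, abs_of_nonneg (Real.sqrt_nonneg _)]
    _ = Real.sqrt (stepSize α₀ (t + 1)) * ∫ ω, ‖ξ (t + 1) i ω‖ ∂P
        + ∫ ω, ‖R (t + 1) i ω‖ ∂P := by
        rw [integral_add h1 h2, integral_const_mul]
    _ ≤ _ := by
        rw [h.integral_norm_gauss]
        gcongr
        exact h.integral_norm_error_le t i

end Noise

/-! ### Summing the consensus error over time. -/

section ConsensusError

variable {m d : ℕ} {Ω : Type*} [MeasurableSpace Ω] {P : Measure Ω} [IsProbabilityMeasure P]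
  {G : ℕ → Digraph (Fin m)} {U : Fin m → EuclideanSpace ℝ (Fin d) → ℝ} {L : NNReal}
  {α₀ : ℝ} {x₀ : Fin m → EuclideanSpace ℝ (Fin d)}
  {b : Ω → ℕ → Fin m → EuclideanSpace ℝ (Fin d)}

lemma IsMixingConstants.norm_iterZ_sub_avgX_le {δ lam : ℝ} (h : IsMixingConstants G δ lam)
    (hm : 0 < m) (U : Fin m → EuclideanSpace ℝ (Fin d) → ℝ) (α₀ : ℝ)
    (x₀ : Fin m → EuclideanSpace ℝ (Fin d)) (b : ℕ → Fin m → EuclideanSpace ℝ (Fin d)) (t : ℕ)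
    (i : Fin m) :
    ‖iterZ G U α₀ x₀ b (t + 1) i - avgX G U α₀ x₀ b t‖
      ≤ ∑ s ∈ Finset.range (t + 1), min 1 (8 * lam ^ (t - s)) / δ *
          ∑ j, ‖if s = 0 then x₀ j else iterE G U α₀ x₀ b s j‖ :=
  h.norm_sub_average_le hm (x := iterX G U α₀ x₀ b)
    -- At time `0` the perturbation is the initial state; the value of `iterE` there plays no role.
    (e := fun s j => if s = 0 then x₀ j else iterE G U α₀ x₀ b s j)
    (by funext j; simp [iterX]) (fun t i => by simp [iterX, iterE, iterZ, consensus]) t i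

lemma IsMixingConstants.integral_sum_norm_le {δ lam : ℝ} (h : IsMixingConstants G δ lam)
    (hm : 0 < m) (hlip : ∀ i, LipschitzWith L (gradient (U i)))
    (hb : ∀ t i, Integrable (fun ω => b ω (t + 1) i) P) {D : ℝ}
    (hD : ∀ s : ℕ, 1 ≤ s → ∀ i, ∫ ω, ‖iterE G U α₀ x₀ (b ω) s i‖ ∂P ≤ D / Real.sqrt s)
    (i : Fin m) (τ : ℕ) :
    ∫ ω, ∑ t ∈ Finset.Icc 1 τ, ‖iterZ G U α₀ x₀ (b ω) (t + 1) i - avgX G U α₀ x₀ (b ω) t‖ ∂P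
      ≤ 8 / δ * (lam / (1 - lam)) * ∑ j, ∑ k, |x₀ j k|
        + 8 / δ * (D * m / (1 - lam)) * (1 + Real.sqrt τ) := by
  have hδ := h.delta_pos
  have hl0 := h.lam_nonneg
  have hl1 : 0 < 1 - lam := by linarith [h.lam_lt_one]
  have hD0 : 0 ≤ D := by
    have := (integral_nonneg fun _ => norm_nonneg _).trans (hD 1 le_rfl i)
    simpa using this
  have he : ∀ s j, Integrable
      (fun ω => ‖if s = 0 then x₀ j else iterE G U α₀ x₀ (b ω) s j‖) P := by
    intro s j
    cases s with
    | zero => simp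
    | succ s => simpa using (integrable_iterE_succ hlip hb s j).norm
  have hes : ∀ s, Integrable
      (fun ω => ∑ j, ‖if s = 0 then x₀ j else iterE G U α₀ x₀ (b ω) s j‖) P :=
    fun s => integrable_finsetSum _ fun j _ => he s j
  set a : ℕ → ℝ := fun s => ∫ ω, ∑ j, ‖if s = 0 then x₀ j else iterE G U α₀ x₀ (b ω) s j‖ ∂P
    with ha
  have ha0 : a 0 = ∑ j, ‖x₀ j‖ := by simp [ha]
  have has : ∀ s, 1 ≤ s → a s ≤ (D * m) / Real.sqrt s := by
    intro s hs
    simp only [ha]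
    rw [integral_finsetSum _ fun j _ => he s j]
    simp only [if_neg (show s ≠ 0 by omega)]
    refine (Finset.sum_le_sum fun j _ => hD s hs j).trans_eq ?_
    simp only [Finset.sum_const, Finset.card_univ, Fintype.card_fin, nsmul_eq_mul]
    ring
  have hi1 : ∀ t s, Integrable (fun ω => min 1 (8 * lam ^ (t - s)) / δ *
      ∑ j, ‖if s = 0 then x₀ j else iterE G U α₀ x₀ (b ω) s j‖) P :=
    fun t s => (hes s).const_mul _
  calc ∫ ω, ∑ t ∈ Finset.Icc 1 τ,
        ‖iterZ G U α₀ x₀ (b ω) (t + 1) i - avgX G U α₀ x₀ (b ω) t‖ ∂P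
      ≤ ∫ ω, ∑ t ∈ Finset.Icc 1 τ, ∑ s ∈ Finset.range (t + 1),
          min 1 (8 * lam ^ (t - s)) / δ *
            ∑ j, ‖if s = 0 then x₀ j else iterE G U α₀ x₀ (b ω) s j‖ ∂P := by
        refine integral_mono (integrable_finsetSum _ fun t _ =>
          ((integrable_iterZ_succ hlip hb t i).sub (integrable_avgX hlip hb t)).norm)
          (integrable_finsetSum _ fun t _ => integrable_finsetSum _ fun s _ => hi1 t s)
          fun ω => Finset.sum_le_sum fun t _ => h.norm_iterZ_sub_avgX_le hm U α₀ x₀ (b ω) t i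
    _ = 1 / δ * ∑ t ∈ Finset.Icc 1 τ, ∑ s ∈ Finset.range (t + 1),
          min 1 (8 * lam ^ (t - s)) * a s := by
        rw [integral_finsetSum _ fun t _ => integrable_finsetSum _ fun s _ => hi1 t s,
          Finset.mul_sum]
        refine Finset.sum_congr rfl fun t _ => ?_
        rw [integral_finsetSum _ fun s _ => hi1 t s, Finset.mul_sum]
        refine Finset.sum_congr rfl fun s _ => ?_
        rw [integral_const_mul]
        ring
    _ ≤ 1 / δ * (8 * (lam / (1 - lam)) * a 0 + 8 * (D * m / (1 - lam)) * Real.sqrt τ) := by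
        refine mul_le_mul_of_nonneg_left ?_ (by positivity)
        exact sum_convolution_le hl0 h.lam_lt_one
          (ha0 ▸ Finset.sum_nonneg fun j _ => norm_nonneg _) has (by positivity) τ
    _ = 8 / δ * (lam / (1 - lam)) * ∑ j, ‖x₀ j‖
        + 8 / δ * (D * m / (1 - lam)) * Real.sqrt τ := by rw [ha0]; ring
    _ ≤ _ := by
        gcongr
        · exact norm_le_sum_abs _
        · linarith

end ConsensusError

end PushLangevin

open PushLangevin in
theorem mainTheorem3 (m d B : ℕ) (hm : 0 < m) (hB : 0 < B)
    (U : Fin m → EuclideanSpace ℝ (Fin d) → ℝ) (L : NNReal) (μ : ℝ) (hμ : 0 < μ)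
    (hdiff : ∀ i, Differentiable ℝ (U i))
    (hlip : ∀ i, LipschitzWith L (gradient (U i)))
    (hconv : ∀ i, StrongConvexOn Set.univ μ (U i))
    (α₀ : ℝ) (hα₀ : 0 < α₀) (σ ρ : ℝ)
    (x₀ : Fin m → EuclideanSpace ℝ (Fin d)) :
    (∀ G : ℕ → Digraph (Fin m), BStronglyConnected G B →
      ∃ δ lam : ℝ, IsMixingConstants G δ lam ∧
        1 / (m : ℝ) ^ (m * B) ≤ δ ∧
        lam ≤ (1 - 1 / (m : ℝ) ^ (m * B)) ^ (1 / ((m : ℝ) * (B : ℝ)))) ∧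
    ∃ D₀ : ℝ, ∀ G : ℕ → Digraph (Fin m), BStronglyConnected G B →
      ∀ (Ω : Type*) [MeasurableSpace Ω] (P : MeasureTheory.Measure Ω)
        [MeasureTheory.IsProbabilityMeasure P]
        (ℱ : MeasureTheory.Filtration ℕ ‹MeasurableSpace Ω›)
        (ξ R : ℕ → Fin m → Ω → EuclideanSpace ℝ (Fin d)),
        IsNoise P ℱ σ ρ ξ R →
        (∀ s : ℕ, 1 ≤ s → ∀ i,
          MeasureTheory.Integrable (fun ω => iterE G U α₀ x₀ (noise α₀ ξ R ω) s i) P ∧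
          ∫ ω, ‖iterE G U α₀ x₀ (noise α₀ ξ R ω) s i‖ ∂P ≤ D₀ / Real.sqrt s) ∧
        ∀ D : ℝ,
          (∀ s : ℕ, 1 ≤ s → ∀ i,
            ∫ ω, ‖iterE G U α₀ x₀ (noise α₀ ξ R ω) s i‖ ∂P ≤ D / Real.sqrt s) →
          ∀ δ lam : ℝ, IsMixingConstants G δ lam → ∀ (i : Fin m) (τ : ℕ),
            (∀ t ∈ Finset.Icc 1 τ, MeasureTheory.Integrable (fun ω =>
              iterZ G U α₀ x₀ (noise α₀ ξ R ω) (t + 1) i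
                - avgX G U α₀ x₀ (noise α₀ ξ R ω) t) P) ∧
            ∫ ω, ∑ t ∈ Finset.Icc 1 τ,
                ‖iterZ G U α₀ x₀ (noise α₀ ξ R ω) (t + 1) i
                  - avgX G U α₀ x₀ (noise α₀ ξ R ω) t‖ ∂P
              ≤ 8 / δ * (lam / (1 - lam)) * ∑ j, ∑ k, |x₀ j k|
                + 8 / δ * (D * m / (1 - lam)) * (1 + Real.sqrt τ) := by
  refine ⟨fun G hG => ⟨_, _, hG.isMixingConstants hm hB, le_rfl, le_rfl⟩, ?_⟩
  have hη : 0 < 1 / (m : ℝ) ^ (m * B) := by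
    have : (0 : ℝ) < m := by exact_mod_cast hm
    positivity
  have hcvx : ∀ i, ConvexOn ℝ Set.univ (U i) := fun i =>
    strongConvexOn_zero.1 ((hconv i).mono hμ.le)
  -- The weights are bounded below by `m^(-mB)` for every admissible graph sequence, so the constant
  -- can be fixed before the graphs and the noise.
  refine ⟨perturbBound L α₀ (1 / (m : ℝ) ^ (m * B)) (Real.sqrt α₀ * (1 + σ ^ 2)
    + ∫ x, ‖x‖ ∂((ProbabilityTheory.stdGaussian (EuclideanSpace ℝ (Fin d))).map
      (fun x => ρ • x))) (∑ j, ‖x₀ j‖) (∑ j, ‖gradient (U j) 0‖),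
    fun G hG Ω _ P _ ℱ ξ R hN => ⟨fun s hs i => ?_, fun D hD δ lam hmix i τ =>
    ⟨fun t _ => ?_, ?_⟩⟩⟩
  · obtain ⟨t, rfl⟩ := Nat.exists_eq_add_of_le' hs
    exact ⟨integrable_iterE_succ hlip hN.integrable_noise t i,
      integral_norm_iterE_succ_le hdiff hcvx hlip hα₀ hη
        (fun t i => by rw [weightY_eq]; exact hG.le_sum_transition hm hB t i)
        hN.integrable_noise (hN.integral_norm_noise_le hα₀) t i⟩
  · exact (integrable_iterZ_succ hlip hN.integrable_noise t i).sub
      (integrable_avgX hlip hN.integrable_noise t)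
  · exact hmix.integral_sum_norm_le hm hlip hN.integrable_noise hD i τ
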